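/- **Matched Euler–Lagrange equations.** Let $G,H$ be (finite-dimensional, real, smooth) Lie groups with Lie algebras $\mathfrak g,\mathfrak h$, and let $(G,H)$ be a matched pair: there are a smooth left action $(h,g)\mapsto h\vartriangleright g=\rho_h(g)$ of $H$ on $G$ and a smooth right action $(h,g)\mapsto h\vartriangleleft g=\sigma_h(g)$ of $G$ on $H$ with $$h\vartriangleright(g_1g_2)=(h\vartriangleright g_1)\big((h\vartriangleleft g_1)\vartriangleright g_2\big),\qquad (h_1h_2)\vartriangleleft g=\big(h_1\vartriangleleft(h_2\vartriangleright g)\big)(h_2\vartriangleleft g).$$ Let $G\bowtie H$ be the Lie group $G\times H$ with product $(g_1,h_1)(g_2,h_2)=(g_1(h_1\vartriangleright g_2),(h_1\vartriangleleft g_2)h_2)$, and $\mathfrak g\bowtie\mathfrak h=\mathfrak g\oplus\mathfrak h$ its Lie algebra. Write $h\vartriangleright\xi=T_{e}\rho_h(\xi)$ for $\xi\in\mathfrak g$ and $\eta\vartriangleleft g=T_e(h\mapsto h\vartriangleleft g)(\eta)$ for $\eta\in\mathfrak h$; let $\eta\vartriangleright\xi$ be the derivative of $h\mapsto h\vartriangleright\xi$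 at $e$ in the direction $\eta$ and $\eta\vartriangleleft\xi$ the derivative of $g\mapsto\eta\vartriangleleft g$ at $e$ in the direction $\xi$; put $\mathfrak b_\xi(\eta)=\eta\vartriangleright\xi$, $\mathfrak a_\eta(\xi)=\eta\vartriangleleft\xi$. For $\mu\in\mathfrak g^*$, $\nu\in\mathfrak h^*$ let $\langle\mu\overset{*}{\vartriangleleft}h,\xi\rangle=\langle\mu,h\vartriangleright\xi\rangle$, $\langle\mu\overset{*}{\vartriangleleft}\eta,\xi\rangle=\langle\mu,\eta\vartriangleright\xi\rangle$, $\langle\xi\overset{*}{\vartriangleright}\nu,\eta\rangle=\langle\nu,\eta\vartriangleleft\xi\rangle$, let $\mathfrak a_\eta^*,\mathfrak b_\xi^*$ be the transposes of $\mathfrak a_\eta,\mathfrak b_\xi$, and let $\langle ad^*_\xi\mu,\xi_2\rangle=-\langle\mu,[\xi,\xi_2]\rangle$ (likewise for $\mathfrak h$ and $\mathfrak g\bowtie\mathfrak h$). $T^*\phi$ is the transpose of $T\phi$, and $L$ denotes left translation. Then: 1. The bracket of $\mathfrak g\bowtie\mathfrak h$ is $[(\xi_1,\eta_1),(\xi_2,\eta_2)]=([\xi_1,\xi_2]+\eta_1\vartriangleright\xi_2-\eta_2\vartriangleright\xi_1,\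 [\eta_1,\eta_2]+\eta_1\vartriangleleft\xi_2-\eta_2\vartriangleleft\xi_1)$. 2. For $\alpha\in T^*_gG$, $\beta\in T^*_hH$: $\;T^*_{(e,e)}L_{(g,h)}(\alpha,\beta)=\big((T^*_eL_g\alpha)\overset{*}{\vartriangleleft}h+T^*_e\sigma_h\beta,\ T^*_eL_h\beta\big)$. 3. $ad^*_{(\xi,\eta)}(\mu,\nu)=\big(ad^*_\xi\mu-\mu\overset{*}{\vartriangleleft}\eta-\mathfrak a^*_\eta\nu,\ ad^*_\eta\nu+\xi\overset{*}{\vartriangleright}\nu+\mathfrak b^*_\xi\mu\big)$. 4. Let $(g,h)(s,t)$ be a smooth two-parameter family in $G\bowtie H$, let $(\xi,\eta)(s,t)$ be its left-trivialized $t$-velocity and $(\xi_2,\eta_2)(t)$ its left-trivialized $s$-velocity at $s=0$. With $\delta=\partial_s|_{s=0}$, at every $t$, $$\delta g=T_e(L_g\circ\rho_h)(\xi_2),\qquad \delta h=T_e\sigma_h(\xi_2)+T_eL_h(\eta_2),$$ $$\delta\xi=\dot\xi_2+[\xi,\xi_2]+\eta\vartriangleright\xi_2-\eta_2\vartriangleright\xi,\qquad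 \delta\eta=\dot\eta_2+[\eta,\eta_2]+\eta\vartriangleleft\xi_2-\eta_2\vartriangleleft\xi.$$ Moreover, for every smooth path in $G\bowtie H$ on $[a,b]$, $a<b$, every smooth $(\xi_2,\eta_2):\mathbb R\to\mathfrak g\oplus\mathfrak h$ vanishing at $a$ and $b$ arises in this way on $[a,b]$ from a smooth variation of the path with fixed endpoints. 5. Let $\mathfrak L=\mathfrak L(g,h,\xi,\eta)$ be a smooth real function on $(G\bowtie H)\ltimes(\mathfrak g\bowtie\mathfrak h)$, with partial derivatives $\frac{\delta\mathfrak L}{\delta g}\in T_g^*G$, $\frac{\delta\mathfrak L}{\delta h}\in T_h^*H$, $\frac{\delta\mathfrak L}{\delta\xi}\in\mathfrak g^*$, $\frac{\delta\mathfrak L}{\delta\eta}\in\mathfrak h^*$. For all curves $(g,h,\xi,\eta)(t)$ and every $t$, the equation $$\frac{d}{dt}\Big(\frac{\delta\mathfrak L}{\delta\xi},\frac{\delta\mathfrak L}{\delta\eta}\Big)=T^*_{(e,e)}L_{(g,h)}\Big(\frac{\delta\mathfrak L}{\delta g},\frac{\delta\mathfrak L}{\delta h}\Big)-ad^*_{(\xi,\eta)}\Big(\frac{\delta\mathfrak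 L}{\delta\xi},\frac{\delta\mathfrak L}{\delta\eta}\Big)$$ holds if and only if the matched Euler–Lagrange equations $$\frac{d}{dt}\frac{\delta\mathfrak L}{\delta\xi}=T^*_eL_g\Big(\frac{\delta\mathfrak L}{\delta g}\Big)\overset{*}{\vartriangleleft}h+T^*_e\sigma_h\Big(\frac{\delta\mathfrak L}{\delta h}\Big)-ad^*_\xi\frac{\delta\mathfrak L}{\delta\xi}+\frac{\delta\mathfrak L}{\delta\xi}\overset{*}{\vartriangleleft}\eta+\mathfrak a^*_\eta\frac{\delta\mathfrak L}{\delta\eta},$$ $$\frac{d}{dt}\frac{\delta\mathfrak L}{\delta\eta}=T^*_eL_h\Big(\frac{\delta\mathfrak L}{\delta h}\Big)-ad^*_\eta\frac{\delta\mathfrak L}{\delta\eta}-\xi\overset{*}{\vartriangleright}\frac{\delta\mathfrak L}{\delta\eta}-\mathfrak b^*_\xi\frac{\delta\mathfrak L}{\delta\xi}$$ hold (derivatives being asserted to exist). Moreover, let $a<b$ and let $(g,h)(t)$ be a smooth curve in $G\bowtie H$ with left-trivialized velocity $(\xi,\eta)(t)=T L_{(g,h)^{-1}}(\dot g,\dot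 h)$. Then $(g,h)$ is an extremal of $\int_a^b\mathfrak L(g,h,\xi,\eta)\,dt$ (that is, the first variation vanishes for all smooth variations with fixed endpoints) if and only if the two matched Euler–Lagrange equations hold for all $t\in[a,b]$. -/

import Mathlib

open scoped Manifold ContDiff

noncomputable section LieGroupDynamics

variable {E : Type*} [NormedAddCommGroup E] [NormedSpace ℝ E]
  {HE : Type*} [TopologicalSpace HE] (I : ModelWithCorners ℝ E HE)
  {M : Type*} [TopologicalSpace M] [ChartedSpace HE M]
  {E' : Type*} [NormedAddCommGroup E'] [NormedSpace ℝ E']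
  {HE' : Type*} [TopologicalSpace HE'] (I' : ModelWithCorners ℝ E' HE')
  {M' : Type*} [TopologicalSpace M'] [ChartedSpace HE' M']

/-- The cotangent space `T*_x M`. -/
abbrev CotangentSpace (x : M) : Type _ := TangentSpace I x →L[ℝ] ℝ

/-- The cotangent lift `T*_x φ : T*_{φ x} M' → T*_x M`, dual to `T_x φ`. -/
def cotangentLift (φ : M → M') (x : M) (β : CotangentSpace I' (φ x)) : CotangentSpace I x :=
  β.comp (mfderiv I I' φ x)

variable [Group M]

variable (M) in
/-- The dual of the Lie algebra of the Lie group `M`. -/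
abbrev LieDual : Type _ := GroupLieAlgebra I M →L[ℝ] ℝ

/-- `T_e L_m : Lie M → T_m M` (as `m * e = m`). -/
def leftLift (m : M) : GroupLieAlgebra I M →L[ℝ] TangentSpace I m :=
  mfderiv I I (fun x : M => m * x) 1

/-- `T*_e L_m : T*_m M → (Lie M)*` (as `m * e = m`). -/
def coLeftLift (m : M) (α : CotangentSpace I m) : LieDual I M :=
  cotangentLift I I (fun x : M => m * x) 1 α

/-- The velocity of the curve `γ` at time `t`. -/
def velocity (γ : ℝ → M) (t : ℝ) : TangentSpace I (γ t) :=
  mfderiv 𝓘(ℝ, ℝ) I γ t (1 : ℝ)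

/-- The left-trivialized velocity `T L_{γ(t)⁻¹} (γ'(t))` of the curve `γ` at time `t`. -/
def leftVelocity (γ : ℝ → M) (t : ℝ) : GroupLieAlgebra I M :=
  mfderiv I I (fun x : M => (γ t)⁻¹ * x) (γ t) (velocity I γ t)

section Coadjoint

variable [FiniteDimensional ℝ E] [LieGroup I ∞ M]

/-- `ad_ξ = [ξ, ·]`. -/
def lieAd (ξ : GroupLieAlgebra I M) : GroupLieAlgebra I M →ₗ[ℝ] GroupLieAlgebra I M :=
  haveI : CompleteSpace E := FiniteDimensional.complete ℝ E
  haveI : LieGroup I (minSmoothness ℝ 3) M :=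
    LieGroup.of_le (n := ∞) (by
      rw [minSmoothness_of_isRCLikeNormedField]
      exact ENat.LEInfty.out)
  { toFun := fun ζ => ⁅ξ, ζ⁆
    map_add' := fun ζ₁ ζ₂ => lie_add ξ ζ₁ ζ₂
    map_smul' := fun c ζ => lie_smul c ξ ζ }

/-- The infinitesimal coadjoint action, `⟨ad*_ξ μ, ζ⟩ = -⟨μ, [ξ, ζ]⟩`. -/
def coad (ξ : GroupLieAlgebra I M) (μ : LieDual I M) : LieDual I M :=
  let φ : E →ₗ[ℝ] ℝ := -(μ.toLinearMap ∘ₗ lieAd I ξ)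
  (LinearMap.toContinuousLinearMap φ : E →L[ℝ] ℝ)

end Coadjoint

/-- The action integral `∫_a^b 𝔏(γ, ζ) dt` of a Lagrangian on the left-trivialized tangent bundle,
with `ζ` the left-trivialized velocity of the path `γ`. -/
def actionIntegral (𝔏 : M → GroupLieAlgebra I M → ℝ) (a b : ℝ) (γ : ℝ → M) : ℝ :=
  ∫ t in a..b, 𝔏 (γ t) (leftVelocity I γ t)

/-- `Γ s t` (with `s` the parameter of the variation) is a smooth variation, with fixed endpoints,
of the path `γ` on `[a, b]`. -/
structure IsFixedEndpointVariation (a b : ℝ) (γ : ℝ → M) (Γ : ℝ → ℝ → M) : Prop where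
  contMDiff : ContMDiff 𝓘(ℝ, ℝ × ℝ) I ∞ (fun p : ℝ × ℝ => Γ p.1 p.2)
  zero : ∀ t ∈ Set.Icc a b, Γ 0 t = γ t
  left : ∀ s, Γ s a = γ a
  right : ∀ s, Γ s b = γ b

/-- `γ` is an extremal of the action integral among the paths with the same endpoints: the first
variation vanishes for every variation with fixed endpoints. -/
def IsExtremal (𝔏 : M → GroupLieAlgebra I M → ℝ) (a b : ℝ) (γ : ℝ → M) : Prop :=
  ∀ Γ : ℝ → ℝ → M, IsFixedEndpointVariation I a b γ Γ →
    HasDerivAt (fun s : ℝ => actionIntegral I 𝔏 a b (Γ s)) 0 0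

end LieGroupDynamics

/-- A matched pair of Lie groups `(G, H)`: a smooth left action `ρ(h, g) = h ▷ g` of `H` on `G` and
a smooth right action `σ(h, g) = h ◁ g` of `G` on `H`, with the compatibility conditions. -/
structure LieMatchedPair {E : Type*} [NormedAddCommGroup E] [NormedSpace ℝ E]
    {HE : Type*} [TopologicalSpace HE] (I : ModelWithCorners ℝ E HE)
    {F : Type*} [NormedAddCommGroup F] [NormedSpace ℝ F]
    {HF : Type*} [TopologicalSpace HF] (J : ModelWithCorners ℝ F HF)
    (G : Type*) [TopologicalSpace G] [ChartedSpace HE G] [Group G]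
    (H : Type*) [TopologicalSpace H] [ChartedSpace HF H] [Group H] where
  rho : H → G → G
  sigma : H → G → H
  contMDiff_rho : ContMDiff (J.prod I) I ∞ (fun p : H × G => rho p.1 p.2)
  contMDiff_sigma : ContMDiff (J.prod I) J ∞ (fun p : H × G => sigma p.1 p.2)
  mul_rho : ∀ h₁ h₂ g, rho (h₁ * h₂) g = rho h₁ (rho h₂ g)
  one_rho : ∀ g, rho 1 g = g
  sigma_mul : ∀ h g₁ g₂, sigma h (g₁ * g₂) = sigma (sigma h g₁) g₂
  sigma_one : ∀ h, sigma h 1 = h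
  rho_mul : ∀ h g₁ g₂, rho h (g₁ * g₂) = rho h g₁ * rho (sigma h g₁) g₂
  mul_sigma : ∀ h₁ h₂ g, sigma (h₁ * h₂) g = sigma h₁ (rho h₂ g) * sigma h₂ g

namespace LieMatchedPair

noncomputable section

variable {E : Type*} [NormedAddCommGroup E] [NormedSpace ℝ E]
  {HE : Type*} [TopologicalSpace HE] {I : ModelWithCorners ℝ E HE}
  {F : Type*} [NormedAddCommGroup F] [NormedSpace ℝ F]
  {HF : Type*} [TopologicalSpace HF] {J : ModelWithCorners ℝ F HF}
  {G : Type*} [TopologicalSpace G] [ChartedSpace HE G] [Group G]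
  {H : Type*} [TopologicalSpace H] [ChartedSpace HF H] [Group H]
  (P : LieMatchedPair I J G H)

/-- The matched pair group `G ⋈ H`: the product manifold `G × H` with the multiplication
`(g₁, h₁) (g₂, h₂) = (g₁ (h₁ ▷ g₂), (h₁ ◁ g₂) h₂)`. -/
@[nolint unusedArguments]
def Bicrossed (_P : LieMatchedPair I J G H) : Type _ := G × H

/-- The point `(g, h)` of `G ⋈ H`. -/
def pt (g : G) (h : H) : P.Bicrossed := (g, h)

variable {P} in
/-- The component in `G`. -/
def Bicrossed.fst (m : P.Bicrossed) : G := Prod.fst (show G × H from m)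

variable {P} in
/-- The component in `H`. -/
def Bicrossed.snd (m : P.Bicrossed) : H := Prod.snd (show G × H from m)

instance : TopologicalSpace P.Bicrossed := inferInstanceAs (TopologicalSpace (G × H))

instance : ChartedSpace (ModelProd HE HF) P.Bicrossed :=
  inferInstanceAs (ChartedSpace (ModelProd HE HF) (G × H))

theorem rho_one (h : H) : P.rho h 1 = 1 := by
  have := P.rho_mul h 1 1
  rw [P.sigma_one, mul_one] at this
  exact (mul_eq_left.mp this.symm)

theorem one_sigma (g : G) : P.sigma 1 g = 1 := by
  have := P.mul_sigma 1 1 g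
  rw [P.one_rho, mul_one] at this
  exact (mul_eq_left.mp this.symm)

instance : Group P.Bicrossed where
  mul x y := P.pt (x.fst * P.rho x.snd y.fst) (P.sigma x.snd y.fst * y.snd)
  one := P.pt 1 1
  inv x := P.pt (P.rho x.snd⁻¹ x.fst⁻¹) (P.sigma x.snd⁻¹ x.fst⁻¹)
  mul_assoc x y z := by
    obtain ⟨g₁, h₁⟩ := x
    obtain ⟨g₂, h₂⟩ := y
    obtain ⟨g₃, h₃⟩ := z
    refine Prod.ext ?_ ?_
    · change g₁ * P.rho h₁ g₂ * P.rho (P.sigma h₁ g₂ * h₂) g₃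
        = g₁ * P.rho h₁ (g₂ * P.rho h₂ g₃)
      rw [P.rho_mul, P.mul_rho, mul_assoc]
    · change P.sigma (P.sigma h₁ g₂ * h₂) g₃ * h₃
        = P.sigma h₁ (g₂ * P.rho h₂ g₃) * (P.sigma h₂ g₃ * h₃)
      rw [P.mul_sigma, P.sigma_mul, mul_assoc]
  one_mul x := by
    obtain ⟨g, h⟩ := x
    refine Prod.ext ?_ ?_
    · change 1 * P.rho 1 g = g
      rw [P.one_rho, one_mul]
    · change P.sigma 1 g * h = h
      rw [P.one_sigma, one_mul]
  mul_one x := by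
    obtain ⟨g, h⟩ := x
    refine Prod.ext ?_ ?_
    · change g * P.rho h 1 = g
      rw [P.rho_one, mul_one]
    · change P.sigma h 1 * 1 = h
      rw [P.sigma_one, mul_one]
  inv_mul_cancel x := by
    obtain ⟨g, h⟩ := x
    refine Prod.ext ?_ ?_
    · change P.rho h⁻¹ g⁻¹ * P.rho (P.sigma h⁻¹ g⁻¹) g = 1
      rw [← P.rho_mul, inv_mul_cancel, P.rho_one]
    · change P.sigma (P.sigma h⁻¹ g⁻¹) g * h = 1
      rw [← P.sigma_mul, inv_mul_cancel, P.sigma_one, inv_mul_cancel]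

instance [LieGroup I ∞ G] [LieGroup J ∞ H] : LieGroup (I.prod J) ∞ P.Bicrossed where
  toIsManifold := inferInstanceAs (IsManifold (I.prod J) ∞ (G × H))
  contMDiff_mul := by
    have h1 : ContMDiff ((I.prod J).prod (I.prod J)) I ∞
        (fun p : (G × H) × (G × H) => p.1.1 * P.rho p.1.2 p.2.1) :=
      (contMDiff_fst.comp contMDiff_fst).mul
        (P.contMDiff_rho.comp ((contMDiff_snd.comp contMDiff_fst).prodMk
          (contMDiff_fst.comp contMDiff_snd)))
    have h2 : ContMDiff ((I.prod J).prod (I.prod J)) J ∞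
        (fun p : (G × H) × (G × H) => P.sigma p.1.2 p.2.1 * p.2.2) :=
      (P.contMDiff_sigma.comp ((contMDiff_snd.comp contMDiff_fst).prodMk
          (contMDiff_fst.comp contMDiff_snd))).mul (contMDiff_snd.comp contMDiff_snd)
    exact h1.prodMk h2
  contMDiff_inv := by
    have h0 : ContMDiff (I.prod J) (J.prod I) ∞ (fun p : G × H => (p.2⁻¹, p.1⁻¹)) :=
      contMDiff_snd.inv.prodMk contMDiff_fst.inv
    exact (P.contMDiff_rho.comp h0).prodMk (P.contMDiff_sigma.comp h0)

/-- The element `(ξ, η)` of `𝔤 ⋈ 𝔥`, the Lie algebra of `G ⋈ H`. -/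
def lieMk (ξ : GroupLieAlgebra I G) (η : GroupLieAlgebra J H) :
    GroupLieAlgebra (I.prod J) P.Bicrossed :=
  ((ξ, η) : E × F)

/-- The component in `𝔤` of an element of `𝔤 ⋈ 𝔥`. -/
def lieFst (ζ : GroupLieAlgebra (I.prod J) P.Bicrossed) : GroupLieAlgebra I G :=
  Prod.fst (show E × F from ζ)

/-- The component in `𝔥` of an element of `𝔤 ⋈ 𝔥`. -/
def lieSnd (ζ : GroupLieAlgebra (I.prod J) P.Bicrossed) : GroupLieAlgebra J H :=
  Prod.snd (show E × F from ζ)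

/-- The covector `(α, β)` at `(g, h)`: `⟨(α, β), (U, V)⟩ = ⟨α, U⟩ + ⟨β, V⟩`. -/
def coMk (g : G) (h : H) (α : CotangentSpace I g) (β : CotangentSpace J h) :
    CotangentSpace (I.prod J) (P.pt g h) :=
  ContinuousLinearMap.coprod (M₁ := E) (M₂ := F) α β

/-- The element `(μ, ν)` of `(𝔤 ⋈ 𝔥)*`: `⟨(μ, ν), (ξ, η)⟩ = ⟨μ, ξ⟩ + ⟨ν, η⟩`. -/
def lieCoMk (μ : LieDual I G) (ν : LieDual J H) : LieDual (I.prod J) P.Bicrossed :=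
  ContinuousLinearMap.coprod (M₁ := E) (M₂ := F) μ ν

/-- `h ▷ · = T_e ρ_h : 𝔤 → 𝔤` (as `h ▷ e = e`). -/
def rhoLie (h : H) : GroupLieAlgebra I G →L[ℝ] GroupLieAlgebra I G :=
  mfderiv I I (fun g : G => P.rho h g) 1

/-- `· ◁ g = T_e σ_g : 𝔥 → 𝔥` (as `e ◁ g = e`). -/
def sigmaLie (g : G) : GroupLieAlgebra J H →L[ℝ] GroupLieAlgebra J H :=
  mfderiv J J (fun h : H => P.sigma h g) 1

/-- The infinitesimal action `P.infRho η ξ = η ▷ ξ`, the derivative at `h = e` of `h ↦ h ▷ ·`. -/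
def infRho : GroupLieAlgebra J H →L[ℝ] (GroupLieAlgebra I G →L[ℝ] GroupLieAlgebra I G) :=
  mfderiv (M' := E →L[ℝ] E) J 𝓘(ℝ, E →L[ℝ] E) (fun h : H => P.rhoLie h) 1

/-- The infinitesimal action `P.infSigma ξ η = η ◁ ξ`, the derivative at `g = e` of `g ↦ · ◁ g`. -/
def infSigma : GroupLieAlgebra I G →L[ℝ] (GroupLieAlgebra J H →L[ℝ] GroupLieAlgebra J H) :=
  mfderiv (M' := F →L[ℝ] F) I 𝓘(ℝ, F →L[ℝ] F) (fun g : G => P.sigmaLie g) 1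

/-- `𝔟_ξ : 𝔥 → 𝔤`, the derivative at `h = e` of `h ↦ h ▷ ξ`. -/
def bMap (ξ : GroupLieAlgebra I G) : GroupLieAlgebra J H →L[ℝ] GroupLieAlgebra I G :=
  mfderiv (M' := E) J 𝓘(ℝ, E) (fun h : H => P.rhoLie h ξ) 1

/-- `𝔞_η : 𝔤 → 𝔥`, the derivative at `g = e` of `g ↦ η ◁ g`. -/
def aMap (η : GroupLieAlgebra J H) : GroupLieAlgebra I G →L[ℝ] GroupLieAlgebra J H :=
  mfderiv (M' := F) I 𝓘(ℝ, F) (fun g : G => P.sigmaLie g η) 1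

/-- `T_e σ_h : 𝔤 → T_h H`, the derivative at `g = e` of `g ↦ h ◁ g` (as `h ◁ e = h`). -/
def sigmaLift (h : H) : GroupLieAlgebra I G →L[ℝ] TangentSpace J h :=
  mfderiv I J (fun g : G => P.sigma h g) 1

/-- `T_e (L_g ∘ ρ_h) : 𝔤 → T_g G` (as `g (h ▷ e) = g`). -/
def leftRhoLift (g : G) (h : H) : GroupLieAlgebra I G →L[ℝ] TangentSpace I g :=
  mfderiv I I (fun x : G => g * P.rho h x) 1

/-- The cotangent lift `T*_e σ_h : T*_h H → 𝔤*`. -/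
def coSigmaLift (h : H) (β : CotangentSpace J h) : LieDual I G :=
  cotangentLift I J (fun g : G => P.sigma h g) 1 β

/-- The dual action `μ ◁* h`, `⟨μ ◁* h, ξ⟩ = ⟨μ, h ▷ ξ⟩`. -/
def coRho (μ : LieDual I G) (h : H) : LieDual I G := μ.comp (P.rhoLie h)

/-- The dual action `μ ◁* η`, `⟨μ ◁* η, ξ⟩ = ⟨μ, η ▷ ξ⟩`. -/
def coInfRho (μ : LieDual I G) (η : GroupLieAlgebra J H) : LieDual I G := μ.comp (P.infRho η)

/-- The dual action `ξ ▷* ν`, `⟨ξ ▷* ν, η⟩ = ⟨ν, η ◁ ξ⟩`. -/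
def coInfSigma (ξ : GroupLieAlgebra I G) (ν : LieDual J H) : LieDual J H := ν.comp (P.infSigma ξ)

/-- The transpose `𝔞*_η : 𝔥* → 𝔤*` of `𝔞_η`. -/
def aStar (η : GroupLieAlgebra J H) (ν : LieDual J H) : LieDual I G := ν.comp (P.aMap η)

/-- The transpose `𝔟*_ξ : 𝔤* → 𝔥*` of `𝔟_ξ`. -/
def bStar (ξ : GroupLieAlgebra I G) (μ : LieDual I G) : LieDual J H := μ.comp (P.bMap ξ)

/-- A Lagrangian `𝔏(g, h, ξ, η)` as a function on `(G ⋈ H) ⋉ (𝔤 ⋈ 𝔥)`. -/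
def lagrangian (𝔏 : G → H → GroupLieAlgebra I G → GroupLieAlgebra J H → ℝ)
    (m : P.Bicrossed) (ζ : GroupLieAlgebra (I.prod J) P.Bicrossed) : ℝ :=
  𝔏 m.fst m.snd (P.lieFst ζ) (P.lieSnd ζ)

end

end LieMatchedPair

noncomputable section FunctionalDerivatives

variable {E : Type*} [NormedAddCommGroup E] [NormedSpace ℝ E]
  {HE : Type*} [TopologicalSpace HE] {I : ModelWithCorners ℝ E HE}
  {F : Type*} [NormedAddCommGroup F] [NormedSpace ℝ F]
  {HF : Type*} [TopologicalSpace HF] {J : ModelWithCorners ℝ F HF}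
  {G : Type*} [TopologicalSpace G] [ChartedSpace HE G] [Group G]
  {H : Type*} [TopologicalSpace H] [ChartedSpace HF H] [Group H]
  (𝔏 : G → H → GroupLieAlgebra I G → GroupLieAlgebra J H → ℝ)
  (g : G) (h : H) (ξ : GroupLieAlgebra I G) (η : GroupLieAlgebra J H)

/-- The partial derivative `δ𝔏/δg` at `(g, h, ξ, η)`. -/
def deltaG : CotangentSpace I g := mfderiv I 𝓘(ℝ, ℝ) (fun x : G => 𝔏 x h ξ η) g

/-- The partial derivative `δ𝔏/δh` at `(g, h, ξ, η)`. -/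
def deltaH : CotangentSpace J h := mfderiv J 𝓘(ℝ, ℝ) (fun y : H => 𝔏 g y ξ η) h

/-- The partial derivative `δ𝔏/δξ` at `(g, h, ξ, η)`. -/
def deltaXi : LieDual I G := fderiv ℝ (fun x : E => 𝔏 g h x η) ξ

/-- The partial derivative `δ𝔏/δη` at `(g, h, ξ, η)`. -/
def deltaEta : LieDual J H := fderiv ℝ (fun y : F => 𝔏 g h ξ y) η

end FunctionalDerivatives

/-!
The computations rest on the Maurer-Cartan equation (`hasDerivAt_leftVelocity_family`): for a smooth
two-parameter family in a Lie group, with left-trivialized velocities `X` in `t` and `Y` in `s`,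
`∂ₛ X = ∂ₜ Y + [X, Y]`. After a left translation the family passes through the identity, and in the
chart there the equation is the symmetry of second derivatives, because the bracket of
left-invariant vector fields is the antisymmetrized derivative of the left translations
(`lie_eq_mfderiv_chartLeftLift`).

The equation also computes brackets. Left translation by `(g, h)` in `G ⋈ H` has at the identity
the differential `(ξ, η) ↦ (T (L_g ∘ ρ_h) ξ, T σ_h ξ + T L_h η)` (`leftLift_pt`), so the velocities
of an explicit family are known. Families in `G` and in `H` give the brackets inside `𝔤` and `𝔥`.
For the mixed bracket take curves `g(t)` and `h(s)` through the identity. The family `(g(t), h(s))`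
gives its `𝔤`-component, since the `t`-velocity at `t = 0` has a component `x(s)` with `h(s) ▷ x(s)`
constant, and the family `(e, h(s)) (g(t), e)` gives its `𝔥`-component, since the `s`-velocity at
`s = 0` has the component `η ◁ g(t)` (`lieFst_lie_lieMk`, `lieSnd_lie_lieMk`, `lie_lieMk`). The
cotangent lift of left translation and the coadjoint action are the transposes of `leftLift_pt` and
`lie_lieMk`, and the variation formulas are the components of the Maurer-Cartan equation in `G ⋈ H`.

A variation with prescribed left-trivialized velocity `ζ` is `γ(t) φ(s ζ(t))`, where `φ` is any
smooth map from the Lie algebra to the group that sends `0` to `e` and has the identity as its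
derivative there (`exists_contMDiff_hasMFDerivAt_id`); a cut-off inverse chart serves, and no
exponential map is needed.

For the extremals, the Maurer-Cartan equation shows that the derivative of the Lagrangian along a
variation is a total time derivative plus the Euler-Lagrange covector paired with the variation
(`fderiv_lagrangian_family`). With fixed endpoints the total derivative integrates to zero, so the
first variation of the action is the integral of that pairing (`hasDerivAt_actionIntegral`). If it
vanishes for all variations, the choice `ζ(t) = (t - a) (b - t) r(t) v`, with `r(t)` the value of
the covector on `v`, makes the integrand nonnegative and forces `r = 0`. On `G ⋈ H` the equation
splits into the two matched equations, since a curve in `(𝔤 ⋈ 𝔥)*` is differentiated componentwise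
(`eulerLagrange_iff`).
-/

/-! ### Derivatives of families of maps at a fixed point -/

section Parametric

variable {E : Type*} [NormedAddCommGroup E] [NormedSpace ℝ E]
  {HE : Type*} [TopologicalSpace HE] {I : ModelWithCorners ℝ E HE}
  {M : Type*} [TopologicalSpace M] [ChartedSpace HE M] [IsManifold I ∞ M]
  {E' : Type*} [NormedAddCommGroup E'] [NormedSpace ℝ E']
  {HE' : Type*} [TopologicalSpace HE'] {I' : ModelWithCorners ℝ E' HE'}
  {M' : Type*} [TopologicalSpace M'] [ChartedSpace HE' M'] [IsManifold I' ∞ M']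
  {N : Type*} {V : Type*} [NormedAddCommGroup V] [NormedSpace ℝ V]

/-- At a fixed base point and a fixed target, the coordinate changes of the tangent bundles are
trivial, so a family of linear maps is its own coordinate expression. -/
theorem inTangentCoordinates_const (p : M) (q : M') (D : N → E →L[ℝ] E') (x₀ : N) :
    inTangentCoordinates I I' (fun _ => p) (fun _ => q) D x₀ = D := by
  ext x v
  rw [inTangentCoordinates_eq _ _ _ (mem_chart_source HE p) (mem_chart_source HE' q)]
  have h1 := (tangentBundleCore I M).coordChange_self (achart HE p) p
    (mem_chart_source HE p) v
  have h2 := (tangentBundleCore I' M').coordChange_self (achart HE' q) q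
    (mem_chart_source HE' q) (D x v)
  rw [ContinuousLinearMap.comp_apply, ContinuousLinearMap.comp_apply, h1, h2]

theorem inTangentCoordinates_vectorSpace (p : M) (g : N → V) (D : N → E →L[ℝ] V) (x₀ : N) :
    inTangentCoordinates I 𝓘(ℝ, V) (fun _ => p) g D x₀ = D := by
  ext x v
  rw [inTangentCoordinates_eq (fun _ => p) g D (mem_chart_source HE p) (Set.mem_univ _)]
  have h1 := (tangentBundleCore I M).coordChange_self (achart HE p) p
    (mem_chart_source HE p) v
  rw [ContinuousLinearMap.comp_apply, ContinuousLinearMap.comp_apply, h1,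
    tangentBundleCore_coordChange_model_space]
  rfl

variable {F : Type*} [NormedAddCommGroup F] [NormedSpace ℝ F]
  {HF : Type*} [TopologicalSpace HF] {J : ModelWithCorners ℝ F HF}
  [TopologicalSpace N] [ChartedSpace HF N] [IsManifold J ∞ N]

/-- If `f` is smooth in both variables and all `f x` send `p` to the same point, then the derivative
of `f x` at `p` depends smoothly on `x`. -/
theorem contMDiffAt_mfderiv_of_const {f : N → M → M'} {p : M} {q : M'} {x₀ : N}
    (hf : ContMDiffAt (J.prod I) I' ∞ (fun z : N × M => f z.1 z.2) (x₀, p))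
    (hq : ∀ x, f x p = q) :
    ContMDiffAt (M' := E →L[ℝ] E') J 𝓘(ℝ, E →L[ℝ] E') ∞
      (fun x => mfderiv I I' (f x) p) x₀ := by
  have h := ContMDiffAt.mfderiv (I := I) (I' := I') (m := ∞) f (fun _ => p) hf
    contMDiffAt_const le_rfl
  have h2 : inTangentCoordinates I I' (fun _ : N => p) (fun x => f x p)
      (fun x => mfderiv I I' (f x) p) x₀ = fun x => mfderiv I I' (f x) p := by
    rw [show (fun x => f x p) = fun _ => q from funext hq]
    exact inTangentCoordinates_const (E := E) (E' := E') p q (fun x => mfderiv I I' (f x) p) x₀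
  exact (congrArg (fun D : N → E →L[ℝ] E' => ContMDiffAt J 𝓘(ℝ, E →L[ℝ] E') ∞ D x₀) h2).mp h

/-- The derivative at a fixed point of a vector-valued map that depends smoothly on a parameter is
a smooth function of the parameter. -/
theorem contMDiffAt_mfderiv_vectorSpace {f : N → M → V} {p : M} {x₀ : N}
    (hf : ContMDiffAt (J.prod I) 𝓘(ℝ, V) ∞ (fun z : N × M => f z.1 z.2) (x₀, p)) :
    ContMDiffAt (M' := E →L[ℝ] V) J 𝓘(ℝ, E →L[ℝ] V) ∞
      (fun x => mfderiv I 𝓘(ℝ, V) (f x) p) x₀ := by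
  have h := ContMDiffAt.mfderiv (I := I) (I' := 𝓘(ℝ, V)) (m := ∞) f (fun _ => p) hf
    contMDiffAt_const le_rfl
  exact (congrArg (fun D : N → E →L[ℝ] V => ContMDiffAt J 𝓘(ℝ, E →L[ℝ] V) ∞ D x₀)
    (inTangentCoordinates_vectorSpace (E := E) (V := V) p (fun x => f x p)
      (fun x => mfderiv I 𝓘(ℝ, V) (f x) p) x₀)).mp h

end Parametric

/-! ### Two-parameter families of points -/

section CurveFamilies

variable {E : Type*} [NormedAddCommGroup E] [NormedSpace ℝ E]
  {HE : Type*} [TopologicalSpace HE] {I : ModelWithCorners ℝ E HE}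
  {M : Type*} [TopologicalSpace M] [ChartedSpace HE M]

theorem contMDiff_right_of_family {Γ : ℝ → ℝ → M}
    (hΓ : ContMDiff 𝓘(ℝ, ℝ × ℝ) I ∞ (fun p : ℝ × ℝ => Γ p.1 p.2)) (s : ℝ) :
    ContMDiff 𝓘(ℝ, ℝ) I ∞ (Γ s) :=
  hΓ.comp (g := fun p : ℝ × ℝ => Γ p.1 p.2) (f := fun t : ℝ => (s, t))
    (contDiff_const.prodMk contDiff_id).contMDiff

theorem contMDiff_swap_of_family {Γ : ℝ → ℝ → M}
    (hΓ : ContMDiff 𝓘(ℝ, ℝ × ℝ) I ∞ (fun p : ℝ × ℝ => Γ p.1 p.2)) :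
    ContMDiff 𝓘(ℝ, ℝ × ℝ) I ∞ (fun p : ℝ × ℝ => Γ p.2 p.1) :=
  hΓ.comp (g := fun p : ℝ × ℝ => Γ p.1 p.2) (f := fun p : ℝ × ℝ => (p.2, p.1))
    (contDiff_snd.prodMk contDiff_fst).contMDiff

theorem velocity_eq_mfderiv_family {Γ : ℝ → ℝ → M}
    (hΓ : ContMDiff 𝓘(ℝ, ℝ × ℝ) I ∞ (fun p : ℝ × ℝ => Γ p.1 p.2)) (s t : ℝ) :
    (velocity I (Γ s) t : E) =
      mfderiv 𝓘(ℝ, ℝ × ℝ) I (fun p : ℝ × ℝ => Γ p.1 p.2) (s, t) ((0, 1) : ℝ × ℝ) := by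
  have h : HasMFDerivAt 𝓘(ℝ, ℝ) 𝓘(ℝ, ℝ × ℝ) (fun u : ℝ => (s, u)) t
      (ContinuousLinearMap.inr ℝ ℝ ℝ) := (hasFDerivAt_prodMk_right s t).hasMFDerivAt
  have h2 := mfderiv_comp_apply (I' := 𝓘(ℝ, ℝ × ℝ)) t
    (hΓ.mdifferentiableAt (x := (s, t)) (by simp)) h.mdifferentiableAt (1 : ℝ)
  rw [h.mfderiv] at h2
  exact h2

theorem velocity_const (x : M) (t : ℝ) : (velocity I (fun _ => x) t : E) = 0 := by
  unfold velocity
  rw [mfderiv_const]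
  rfl

end CurveFamilies

/-! ### Left translations and left-trivialized velocities -/

section LeftVelocity

variable {E : Type*} [NormedAddCommGroup E] [NormedSpace ℝ E]
  {HE : Type*} [TopologicalSpace HE] {I : ModelWithCorners ℝ E HE}
  {K : Type*} [TopologicalSpace K] [ChartedSpace HE K] [Group K]

theorem leftLift_one (v : GroupLieAlgebra I K) : (leftLift I (1 : K) v : E) = v := by
  have : (fun x : K => 1 * x) = id := by ext; simp
  unfold leftLift
  rw [this, mfderiv_id]
  rfl

variable [LieGroup I ∞ K]

theorem mdifferentiableAt_mul_left_of_lieGroup (k x : K) :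
    MDifferentiableAt I I (fun y : K => k * y) x :=
  (contMDiff_mul_left (I := I) (n := ∞) (a := k)).contMDiffAt.mdifferentiableAt (by simp)

theorem mfderiv_inv_mul_leftLift (k : K) (v : GroupLieAlgebra I K) :
    (mfderiv I I (fun x : K => k⁻¹ * x) k (leftLift I k v) : E) = v := by
  have h := mfderiv_comp_apply_of_eq (I := I) (I' := I) (I'' := I) (x := (1 : K)) (y := k)
    (f := fun x : K => k * x) (g := fun x : K => k⁻¹ * x)
    (mdifferentiableAt_mul_left_of_lieGroup _ _) (mdifferentiableAt_mul_left_of_lieGroup _ _)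
    (mul_one k) v
  have h2 : (fun x : K => k⁻¹ * x) ∘ (fun x : K => k * x) = id := by ext; simp
  rw [h2, mfderiv_id] at h
  exact h.symm

theorem leftLift_mfderiv_inv_mul (k : K) (v : TangentSpace I k) :
    leftLift I k (mfderiv I I (fun x : K => k⁻¹ * x) k v : E) = v := by
  have h := mfderiv_comp_apply_of_eq (I := I) (I' := I) (I'' := I) (x := k) (y := (1 : K))
    (f := fun x : K => k⁻¹ * x) (g := fun x : K => k * x)
    (mdifferentiableAt_mul_left_of_lieGroup _ _) (mdifferentiableAt_mul_left_of_lieGroup _ _)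
    (inv_mul_cancel k) v
  have h2 : (fun x : K => k * x) ∘ (fun x : K => k⁻¹ * x) = id := by ext; simp
  rw [h2, mfderiv_id] at h
  exact h.symm

theorem leftLift_leftVelocity (γ : ℝ → K) (t : ℝ) :
    leftLift I (γ t) (leftVelocity I γ t) = velocity I γ t :=
  leftLift_mfderiv_inv_mul _ _

theorem leftVelocity_eq_of_leftLift_eq {γ : ℝ → K} {t : ℝ} {v : GroupLieAlgebra I K}
    (h : leftLift I (γ t) v = velocity I γ t) : leftVelocity I γ t = v := by
  have := mfderiv_inv_mul_leftLift (I := I) (γ t) v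
  rw [h] at this
  exact this

theorem leftVelocity_eq_mfderiv {γ : ℝ → K} {t : ℝ} (hγ : MDifferentiableAt 𝓘(ℝ, ℝ) I γ t) :
    (leftVelocity I γ t : E) =
      mfderiv 𝓘(ℝ, ℝ) I (fun u => (γ t)⁻¹ * γ u) t (1 : ℝ) :=
  (mfderiv_comp_apply (I' := I) t (mdifferentiableAt_mul_left_of_lieGroup (γ t)⁻¹ (γ t)) hγ
    (1 : ℝ)).symm

theorem leftVelocity_const_mul {γ : ℝ → K} {t : ℝ} (hγ : MDifferentiableAt 𝓘(ℝ, ℝ) I γ t) (k : K) :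
    leftVelocity I (fun u => k * γ u) t = leftVelocity I γ t := by
  have h := leftVelocity_eq_mfderiv (I := I)
    ((mdifferentiableAt_mul_left_of_lieGroup (I := I) k (γ t)).comp t hγ)
  have h2 : (fun u => (k * γ t)⁻¹ * (k * γ u)) = fun u => (γ t)⁻¹ * γ u := by
    ext u; group
  exact h.trans ((congrArg (fun f : ℝ → K => (mfderiv 𝓘(ℝ, ℝ) I f t (1 : ℝ) : E)) h2).trans
    (leftVelocity_eq_mfderiv hγ).symm)

/-- The left-trivialized velocity of a smooth family of curves is smooth in both variables. -/
theorem contDiff_leftVelocity {Γ : ℝ → ℝ → K}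
    (hΓ : ContMDiff 𝓘(ℝ, ℝ × ℝ) I ∞ (fun p : ℝ × ℝ => Γ p.1 p.2)) :
    ContDiff (F := E) ℝ ∞ (fun p : ℝ × ℝ => leftVelocity I (Γ p.1) p.2) := by
  -- the velocity at `t` is read off at the fixed parameter `0` of the shifted curve
  have key : ∀ p : ℝ × ℝ, (leftVelocity I (Γ p.1) p.2 : E) =
      (mfderiv 𝓘(ℝ, ℝ) I (fun u => (Γ p.1 p.2)⁻¹ * Γ p.1 (p.2 + u)) 0 : ℝ →L[ℝ] E) 1 := by
    rintro ⟨s, t⟩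
    have hs : MDifferentiableAt 𝓘(ℝ, ℝ) I (Γ s) t :=
      (contMDiff_right_of_family hΓ s).mdifferentiableAt (by simp)
    rw [leftVelocity_eq_mfderiv hs]
    have h1 : MDifferentiableAt 𝓘(ℝ, ℝ) I (fun u => (Γ s t)⁻¹ * Γ s u) t :=
      (mdifferentiableAt_mul_left_of_lieGroup (I := I) (Γ s t)⁻¹ (Γ s t)).comp t hs
    have h2 : HasMFDerivAt 𝓘(ℝ, ℝ) 𝓘(ℝ, ℝ) (fun u : ℝ => t + u) 0
        (ContinuousLinearMap.id ℝ ℝ) :=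
      ((hasFDerivAt_id (0 : ℝ)).const_add t).hasMFDerivAt
    have h3 := mfderiv_comp_apply_of_eq (I := 𝓘(ℝ, ℝ)) (I' := 𝓘(ℝ, ℝ)) (I'' := I)
      (x := (0 : ℝ)) (y := t) (f := fun u : ℝ => t + u) h1 h2.mdifferentiableAt (add_zero t)
      (1 : ℝ)
    rw [h2.mfderiv] at h3
    exact h3.symm
  have hsm : ContMDiff (𝓘(ℝ, ℝ × ℝ).prod 𝓘(ℝ, ℝ)) I ∞
      (fun z : (ℝ × ℝ) × ℝ => (Γ z.1.1 z.1.2)⁻¹ * Γ z.1.1 (z.1.2 + z.2)) := by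
    have h1 : ContMDiff (𝓘(ℝ, ℝ × ℝ).prod 𝓘(ℝ, ℝ)) I ∞
        (fun z : (ℝ × ℝ) × ℝ => Γ z.1.1 z.1.2) := hΓ.comp contMDiff_fst
    have h2 : ContMDiff (𝓘(ℝ, ℝ × ℝ).prod 𝓘(ℝ, ℝ)) 𝓘(ℝ, ℝ × ℝ) ∞
        (fun z : (ℝ × ℝ) × ℝ => ((z.1.1, z.1.2 + z.2) : ℝ × ℝ)) := by
      have h : ContDiff ℝ ∞ (fun z : (ℝ × ℝ) × ℝ => ((z.1.1, z.1.2 + z.2) : ℝ × ℝ)) := by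
        fun_prop
      have h' := h.contMDiff
      rw [modelWithCornersSelf_prod, ← chartedSpaceSelf_prod] at h'
      exact h'
    exact h1.inv.mul (hΓ.comp h2)
  refine contDiff_iff_contDiffAt.2 fun p => ?_
  have h := contMDiffAt_mfderiv_of_const (I := 𝓘(ℝ, ℝ)) (I' := I) (J := 𝓘(ℝ, ℝ × ℝ))
    (f := fun (z : ℝ × ℝ) (u : ℝ) => (Γ z.1 z.2)⁻¹ * Γ z.1 (z.2 + u)) (p := 0) (q := 1) (x₀ := p)
    (hsm _) (by simp)
  have := (contMDiffAt_iff_contDiffAt.1 h).clm_apply (contDiffAt_const (c := (1 : ℝ)))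
  exact this.congr_of_eventuallyEq (.of_forall key)

/-- The left-trivialized velocity in the first parameter of a smooth family is smooth in the second
parameter. -/
theorem contDiff_leftVelocity_left {Γ : ℝ → ℝ → K}
    (hΓ : ContMDiff 𝓘(ℝ, ℝ × ℝ) I ∞ (fun p : ℝ × ℝ => Γ p.1 p.2)) (s : ℝ) :
    ContDiff (F := E) ℝ ∞ (fun t => leftVelocity I (fun s' => Γ s' t) s) :=
  (contDiff_leftVelocity (Γ := fun t s => Γ s t) (contMDiff_swap_of_family hΓ)).comp
    (contDiff_prodMk_left s)

theorem contDiff_leftVelocity_curve {γ : ℝ → K} (hγ : ContMDiff 𝓘(ℝ, ℝ) I ∞ γ) :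
    ContDiff (F := E) ℝ ∞ (fun t => leftVelocity I γ t) := by
  have h : ContMDiff 𝓘(ℝ, ℝ × ℝ) I ∞ (fun p : ℝ × ℝ => γ p.2) :=
    hγ.comp (contDiff_snd (𝕜 := ℝ) (E := ℝ) (F := ℝ)).contMDiff
  exact (contDiff_leftVelocity (Γ := fun _ => γ) h).comp
    (contDiff_const (c := (0 : ℝ)).prodMk contDiff_id)

end LeftVelocity

/-! ### The Lie bracket in the chart at the identity -/

section Chart

open VectorField

variable {E : Type*} [NormedAddCommGroup E] [NormedSpace ℝ E]
  {HE : Type*} [TopologicalSpace HE] {I : ModelWithCorners ℝ E HE}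

section Manifold

variable {M : Type*} [TopologicalSpace M] [ChartedSpace HE M] [IsManifold I ∞ M]

/-- The tangent space at `x` is identified with the model space through the preferred chart at `x`;
hence the derivative of that chart at `x` is the identity. -/
theorem hasMFDerivAt_extChartAt_self (x : M) :
    HasMFDerivAt I 𝓘(ℝ, E) (extChartAt I x) x (ContinuousLinearMap.id ℝ E) := by
  have h := hasMFDerivAt_extChartAt (I := I) (mem_chart_source HE x)
  have h2 : (mfderiv I I (chartAt HE x) x : E →L[ℝ] E) = ContinuousLinearMap.id ℝ E := by
    ext v
    refine (congrArg (fun D : E →L[ℝ] E => D v)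
      (mfderiv_chartAt_eq_tangentCoordChange (I := I) (mem_chart_source HE x))).trans ?_
    exact tangentCoordChange_self (mem_extChartAt_source x)
  exact (congrArg (fun D : E →L[ℝ] E => HasMFDerivAt I 𝓘(ℝ, E) (extChartAt I x) x D) h2).mp h

theorem hasMFDerivAt_extChartAt_symm_self [I.Boundaryless] (x : M) :
    HasMFDerivAt 𝓘(ℝ, E) I (extChartAt I x).symm (extChartAt I x x)
      (ContinuousLinearMap.id ℝ E) := by
  have h1 := mdifferentiableWithinAt_extChartAt_symm (I := I) (mem_extChartAt_target x)
  rw [I.range_eq_univ, mdifferentiableWithinAt_univ] at h1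
  have h2 := mfderivWithin_extChartAt_symm_comp_mfderiv_extChartAt' (I := I)
    (mem_extChartAt_source x)
  rw [(hasMFDerivAt_extChartAt_self x).mfderiv, I.range_eq_univ, mfderivWithin_univ] at h2
  have h3 : (mfderiv 𝓘(ℝ, E) I (extChartAt I x).symm (extChartAt I x x) : E →L[ℝ] E)
      = ContinuousLinearMap.id ℝ E := h2
  exact (congrArg (fun D : E →L[ℝ] E =>
    HasMFDerivAt 𝓘(ℝ, E) I (extChartAt I x).symm (extChartAt I x x) D) h3).mp h1.hasMFDerivAt

end Manifold

variable {K : Type*} [TopologicalSpace K] [ChartedSpace HE K] [Group K]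

variable (I) in
/-- The differential at `1` of left translation by `k`, with its values read in the chart at `1`.
As a function of `k` it takes its values in a fixed space of linear maps, so it can be
differentiated. -/
noncomputable def chartLeftLift (k : K) : E →L[ℝ] E :=
  mfderiv I 𝓘(ℝ, E) (fun y : K => extChartAt I (1 : K) (k * y)) 1

variable (I K) in
/-- The derivative at `1` of `chartLeftLift`, as a bilinear map `leftLiftDeriv u v` in the
direction `u` and the argument `v`. -/
noncomputable def leftLiftDeriv : E →L[ℝ] E →L[ℝ] E :=
  mfderiv I 𝓘(ℝ, E →L[ℝ] E) (chartLeftLift I) (1 : K)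

variable [LieGroup I ∞ K]

theorem chartLeftLift_apply {k : K} (hk : k ∈ (chartAt HE (1 : K)).source) (v : E) :
    chartLeftLift I k v =
      (mfderiv I 𝓘(ℝ, E) (extChartAt I (1 : K)) k (leftLift I k v) : E) :=
  mfderiv_comp_apply_of_eq (I' := I) (g := extChartAt I (1 : K)) (f := fun y : K => k * y) _
    (mdifferentiableAt_extChartAt hk) (mdifferentiableAt_mul_left_of_lieGroup k 1) (mul_one k) v

theorem chartLeftLift_one : chartLeftLift I (1 : K) = ContinuousLinearMap.id ℝ E := by
  have h : (fun y : K => extChartAt I (1 : K) (1 * y)) = extChartAt I (1 : K) := by ext; simp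
  unfold chartLeftLift
  rw [h]
  exact (hasMFDerivAt_extChartAt_self (I := I) (1 : K)).mfderiv

theorem contMDiffAt_chartLeftLift :
    ContMDiffAt I 𝓘(ℝ, E →L[ℝ] E) ∞ (chartLeftLift I : K → E →L[ℝ] E) 1 := by
  refine contMDiffAt_mfderiv_vectorSpace (I := I) (J := I)
    (f := fun k y : K => extChartAt I (1 : K) (k * y)) ?_
  have h : ContMDiffAt I 𝓘(ℝ, E) ∞ (extChartAt I (1 : K)) (1 * 1) := by
    rw [one_mul]; exact contMDiffAt_extChartAt
  exact h.comp (f := fun z : K × K => z.1 * z.2) (x := ((1, 1) : K × K))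
    (contMDiff_mul I ∞).contMDiffAt

/-- In the chart at `1`, the bracket is the antisymmetrized derivative at `1` of the left
translations. -/
theorem lie_eq_mfderiv_chartLeftLift [I.Boundaryless] (v w : GroupLieAlgebra I K) :
    (⁅v, w⁆ : GroupLieAlgebra I K) =
      (leftLiftDeriv I K v w - leftLiftDeriv I K w v : E) := by
  set φ := extChartAt I (1 : K) with hφ
  set D : E →L[ℝ] E →L[ℝ] E := leftLiftDeriv I K
  -- in the chart at `1`, the left-invariant vector field of `u` is `x ↦ chartLeftLift x u`
  have hV : ∀ u : E, (mpullbackWithin 𝓘(ℝ, E) I φ.symm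
      (mulInvariantVectorField (u : GroupLieAlgebra I K)) (Set.range I) : E → E)
      =ᶠ[nhds (φ 1)] fun x => chartLeftLift I (φ.symm x) u := by
    intro u
    filter_upwards [extChartAt_target_mem_nhds (I := I) (1 : K)] with x hx
    have hx' : φ.symm x ∈ (chartAt HE (1 : K)).source := by
      have := φ.map_target hx
      rwa [hφ, extChartAt_source] at this
    rw [chartLeftLift_apply hx']
    have := ContinuousLinearMap.inverse_eq
      (mfderivWithin_extChartAt_symm_comp_mfderiv_extChartAt hx)
      (mfderiv_extChartAt_comp_mfderivWithin_extChartAt_symm hx)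
    exact congrArg (fun A : E →L[ℝ] E => A (leftLift I (φ.symm x) u)) this
  have hA : HasFDerivAt (fun x => chartLeftLift I (φ.symm x)) D (φ 1) := by
    have h1 : HasMFDerivAt I 𝓘(ℝ, E →L[ℝ] E) (chartLeftLift I) (φ.symm (φ 1)) D := by
      rw [hφ, extChartAt_to_inv]
      exact ((contMDiffAt_chartLeftLift (I := I)).mdifferentiableAt (by simp)).hasMFDerivAt
    have h2 := h1.comp (φ 1) (hasMFDerivAt_extChartAt_symm_self (I := I) (1 : K))
    exact (hasMFDerivAt_iff_hasFDerivAt.1 h2 : HasFDerivAt _ (D.comp (.id ℝ E)) (φ 1))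
  have hd : ∀ u u' : E, fderiv ℝ (mpullbackWithin 𝓘(ℝ, E) I φ.symm
      (mulInvariantVectorField (u : GroupLieAlgebra I K)) (Set.range I) : E → E) (φ 1) u'
      = D u' u := by
    intro u u'
    rw [(hV u).fderiv_eq]
    have h := hA.clm_apply (hasFDerivAt_const u (φ 1))
    rw [h.fderiv]
    simp
  have h0 : ∀ u : E, (mpullbackWithin 𝓘(ℝ, E) I φ.symm
      (mulInvariantVectorField (u : GroupLieAlgebra I K)) (Set.range I) : E → E) (φ 1) = u := by
    intro u
    refine (hV u).self_of_nhds.trans ?_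
    change chartLeftLift I (φ.symm (φ 1)) u = u
    rw [hφ, extChartAt_to_inv, chartLeftLift_one]
    rfl
  set V : E → E := mpullbackWithin 𝓘(ℝ, E) I φ.symm (mulInvariantVectorField v) (Set.range I)
    with hVdef
  set W : E → E := mpullbackWithin 𝓘(ℝ, E) I φ.symm (mulInvariantVectorField w) (Set.range I)
    with hWdef
  have hbr : (⁅v, w⁆ : GroupLieAlgebra I K) = (mfderiv I 𝓘(ℝ, E) φ (1 : K)).inverse
      (lieBracketWithin ℝ V W (φ.symm ⁻¹' Set.univ ∩ Set.range I) (φ 1) : E) := rfl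
  have hs : φ.symm ⁻¹' Set.univ ∩ Set.range I = Set.univ := by
    rw [I.range_eq_univ, Set.preimage_univ, Set.univ_inter]
  have hl : (lieBracketWithin ℝ V W (φ.symm ⁻¹' Set.univ ∩ Set.range I) (φ 1) : E)
      = D v w - D w v := by
    rw [hs, lieBracketWithin_univ]
    have h1 : V (φ 1) = v := h0 v
    have h2 : W (φ 1) = w := h0 w
    have h3 : fderiv ℝ W (φ 1) v = D v w := hd w v
    have h4 : fderiv ℝ V (φ 1) w = D w v := hd v w
    change fderiv ℝ W (φ 1) (V (φ 1)) - fderiv ℝ V (φ 1) (W (φ 1)) = D v w - D w v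
    rw [h1, h2, h3, h4]
  have hi : ∀ u : E, ((mfderiv I 𝓘(ℝ, E) φ (1 : K)).inverse u : E) = u := by
    intro u
    rw [hφ, (hasMFDerivAt_extChartAt_self (I := I) (1 : K)).mfderiv]
    exact congrArg (fun A : E →L[ℝ] E => A u) ContinuousLinearMap.inverse_id
  rw [hbr, hl]
  exact hi _

/-- A smooth map `E → K` that sends `0` to `1` and has the identity as its derivative at `0`; it
plays the role of the exponential map. -/
theorem exists_contMDiff_hasMFDerivAt_id [I.Boundaryless] [FiniteDimensional ℝ E] :
    ∃ e : E → K, ContMDiff 𝓘(ℝ, E) I ∞ e ∧ e 0 = 1 ∧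
      HasMFDerivAt 𝓘(ℝ, E) I e 0 (ContinuousLinearMap.id ℝ E) := by
  obtain ⟨r, hr, hball⟩ := Metric.mem_nhds_iff.1 (extChartAt_target_mem_nhds (I := I) (1 : K))
  -- the chart inverse is defined only on an open set, so its argument is cut off
  let χ : ContDiffBump (0 : E) := ⟨r / 2, r, by positivity, by linarith⟩
  have hmem : ∀ v : E, extChartAt I (1 : K) 1 + χ v • v ∈ (extChartAt I (1 : K)).target := by
    intro v
    apply hball
    rw [mem_ball_iff_norm, add_sub_cancel_left, norm_smul, Real.norm_of_nonneg χ.nonneg]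
    by_cases hv : ‖v‖ < r
    · exact (mul_le_of_le_one_left (norm_nonneg v) χ.le_one).trans_lt hv
    · rw [χ.zero_of_le_dist (by simpa [dist_zero_right] using hv), zero_mul]
      exact hr
  have hsm : ContDiff ℝ ∞ (fun v : E => extChartAt I (1 : K) 1 + χ v • v) :=
    contDiff_const.add (χ.contDiff.smul contDiff_id)
  refine ⟨fun v => (extChartAt I (1 : K)).symm (extChartAt I (1 : K) 1 + χ v • v), ?_, ?_, ?_⟩
  · exact (contMDiffOn_extChartAt_symm (I := I) (n := ∞) (1 : K)).comp_contMDiff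
      hsm.contMDiff hmem
  · simp
  · have h1 : HasFDerivAt (fun v : E => extChartAt I (1 : K) 1 + χ v • v)
        (ContinuousLinearMap.id ℝ E) 0 := by
      refine ((hasFDerivAt_id (0 : E)).const_add (extChartAt I (1 : K) 1)).congr_of_eventuallyEq ?_
      filter_upwards [χ.eventuallyEq_one] with v hv
      rw [hv]
      simp
    have h2 := hasMFDerivAt_extChartAt_symm_self (I := I) (1 : K)
    have h3 : extChartAt I (1 : K) 1 + χ 0 • (0 : E) = extChartAt I (1 : K) 1 := by simp
    rw [← h3] at h2
    exact h2.comp (0 : E) h1.hasMFDerivAt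

end Chart

/-! ### The Maurer-Cartan equation for a two-parameter family -/

section MaurerCartan

variable {E : Type*} [NormedAddCommGroup E] [NormedSpace ℝ E]
  {HE : Type*} [TopologicalSpace HE] {I : ModelWithCorners ℝ E HE}
  {K : Type*} [TopologicalSpace K] [ChartedSpace HE K] [Group K] [LieGroup I ∞ K]

/-- In the chart at `1`, the `t`-derivative of a family is its left-trivialized velocity, carried
along by the left translation. -/
theorem fderiv_extChartAt_family {Γ : ℝ → ℝ → K}
    (hΓ : ContMDiff 𝓘(ℝ, ℝ × ℝ) I ∞ (fun p : ℝ × ℝ => Γ p.1 p.2)) {p : ℝ × ℝ}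
    (hp : Γ p.1 p.2 ∈ (chartAt HE (1 : K)).source) :
    fderiv ℝ (fun p : ℝ × ℝ => extChartAt I (1 : K) (Γ p.1 p.2)) p (0, 1) =
      chartLeftLift I (Γ p.1 p.2) (leftVelocity I (Γ p.1) p.2) := by
  refine Eq.trans ?_ (chartLeftLift_apply (E := E) hp (leftVelocity I (Γ p.1) p.2)).symm
  have h0 := congrArg
    (fun v : E => (mfderiv I 𝓘(ℝ, E) (extChartAt I (1 : K)) (Γ p.1 p.2) v : E))
    (leftLift_leftVelocity (I := I) (Γ p.1) p.2)
  refine Eq.trans ?_ h0.symm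
  have h1 := mfderiv_comp_apply (I' := I) p (g := extChartAt I (1 : K))
    (mdifferentiableAt_extChartAt hp) (hΓ.mdifferentiableAt (x := p) (by simp))
    ((0, 1) : ℝ × ℝ)
  have h2 := velocity_eq_mfderiv_family hΓ p.1 p.2
  rw [mfderiv_eq_fderiv] at h1
  exact h1.trans (congrArg
    (fun v : E => (mfderiv I 𝓘(ℝ, E) (extChartAt I (1 : K)) (Γ p.1 p.2) v : E)) h2.symm)

variable [I.Boundaryless]

/-- The Maurer-Cartan equation at a parameter at which the family passes through `1`. There, with
`c` the family read in the chart at `1`, the equation is the symmetry of the second derivative of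
`c`: one has `∂ₜ c = b X` and `∂ₛ c = b Y`, where the derivative of the left translation `b` is
`leftLiftDeriv`, whose antisymmetrization is the bracket. -/
theorem hasDerivAt_leftVelocity_family_of_eq_one {Γ : ℝ → ℝ → K}
    (hΓ : ContMDiff 𝓘(ℝ, ℝ × ℝ) I ∞ (fun p : ℝ × ℝ => Γ p.1 p.2)) {s t : ℝ} (h1 : Γ s t = 1) :
    HasDerivAt (fun s' => leftVelocity I (Γ s') t)
      (deriv (fun t' => leftVelocity I (fun s' => Γ s' t') s) t +
        ⁅leftVelocity I (Γ s) t, leftVelocity I (fun s' => Γ s' t) s⁆) s := by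
  have hΓ' := contMDiff_swap_of_family hΓ
  let X : ℝ × ℝ → E := fun p => leftVelocity I (Γ p.1) p.2
  let Y : ℝ × ℝ → E := fun p => leftVelocity I (fun s' => Γ s' p.2) p.1
  have hX : ContDiff ℝ ∞ X := contDiff_leftVelocity hΓ
  have hY : ContDiff ℝ ∞ Y :=
    (contDiff_leftVelocity (Γ := fun t s => Γ s t) hΓ').comp (contDiff_snd.prodMk contDiff_fst)
  let c : ℝ × ℝ → E := fun p => extChartAt I (1 : K) (Γ p.1 p.2)
  let b : ℝ × ℝ → E →L[ℝ] E := fun p => chartLeftLift I (Γ p.1 p.2)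
  set p₀ : ℝ × ℝ := (s, t) with hp₀
  have hsrc : ∀ᶠ p in nhds p₀, Γ p.1 p.2 ∈ (chartAt HE (1 : K)).source := by
    apply hΓ.continuous.continuousAt.eventually_mem
    rw [hp₀, h1]
    exact chart_source_mem_nhds HE 1
  have hc : ContDiffAt ℝ ∞ c p₀ := by
    rw [← contMDiffAt_iff_contDiffAt]
    have h : ContMDiffAt I 𝓘(ℝ, E) ∞ (extChartAt I (1 : K)) (Γ s t) := by
      rw [h1]; exact contMDiffAt_extChartAt
    exact h.comp p₀ (hΓ p₀)
  have hcX : (fun p => fderiv ℝ c p (0, 1)) =ᶠ[nhds p₀] fun p => b p (X p) := by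
    filter_upwards [hsrc] with p hp
    exact fderiv_extChartAt_family hΓ hp
  have hcY : (fun p => fderiv ℝ c p (1, 0)) =ᶠ[nhds p₀] fun p => b p (Y p) := by
    have hc' : ∀ᶠ p in nhds p₀, DifferentiableAt ℝ c p :=
      ((hc.of_le (m := 1) ENat.LEInfty.out).eventually (by simp)).mono
        fun p hp => hp.differentiableAt (by simp)
    filter_upwards [hsrc, hc'] with p hp hcp
    -- the same formula for the family with its two parameters exchanged
    have h := fderiv_extChartAt_family (Γ := fun t s => Γ s t) hΓ' (p := (p.2, p.1)) hp
    refine Eq.trans ?_ h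
    have h2 : HasFDerivAt (fun q : ℝ × ℝ => (q.2, q.1))
        ((ContinuousLinearMap.snd ℝ ℝ ℝ).prod (ContinuousLinearMap.fst ℝ ℝ ℝ)) (p.2, p.1) :=
      hasFDerivAt_snd.prodMk hasFDerivAt_fst
    have h3 := (HasFDerivAt.comp (p.2, p.1) (g := c) hcp.hasFDerivAt h2).fderiv
    have h4 := congrArg (fun A : ℝ × ℝ →L[ℝ] E => A (0, 1)) h3
    exact h4.symm
  have hb0 : b p₀ = ContinuousLinearMap.id ℝ E := by
    change chartLeftLift I (Γ s t) = _
    rw [h1, chartLeftLift_one]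
  have hX0 : fderiv ℝ c p₀ (0, 1) = X p₀ := by
    refine hcX.self_of_nhds.trans ?_
    change b p₀ (X p₀) = X p₀
    rw [hb0, ContinuousLinearMap.id_apply]
  have hY0 : fderiv ℝ c p₀ (1, 0) = Y p₀ := by
    refine hcY.self_of_nhds.trans ?_
    change b p₀ (Y p₀) = Y p₀
    rw [hb0, ContinuousLinearMap.id_apply]
  -- the derivative of the trivialization along the family
  let D : E →L[ℝ] E →L[ℝ] E := leftLiftDeriv I K
  have hb : HasFDerivAt b (D.comp (fderiv ℝ c p₀)) p₀ := by
    let A : ℝ × ℝ →L[ℝ] E := mfderiv 𝓘(ℝ, ℝ × ℝ) I (fun p : ℝ × ℝ => Γ p.1 p.2) p₀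
    have hA : HasMFDerivAt 𝓘(ℝ, ℝ × ℝ) I (fun p : ℝ × ℝ => Γ p.1 p.2) p₀ A :=
      (hΓ.mdifferentiableAt (x := p₀) (by simp)).hasMFDerivAt
    have h2 : HasMFDerivAt I 𝓘(ℝ, E →L[ℝ] E) (chartLeftLift I) (Γ s t) D := by
      rw [h1]
      exact ((contMDiffAt_chartLeftLift (I := I)).mdifferentiableAt (by simp)).hasMFDerivAt
    have h5 : HasMFDerivAt I 𝓘(ℝ, E) (extChartAt I (1 : K)) (Γ s t)
        (ContinuousLinearMap.id ℝ E) := by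
      rw [h1]; exact hasMFDerivAt_extChartAt_self 1
    have h3 : HasFDerivAt b (D.comp A) p₀ := hasMFDerivAt_iff_hasFDerivAt.1 (h2.comp p₀ hA)
    have h4 : HasFDerivAt c ((ContinuousLinearMap.id ℝ E).comp A) p₀ :=
      hasMFDerivAt_iff_hasFDerivAt.1 (h5.comp p₀ hA)
    rw [h4.fderiv]
    exact h3
  have hXd := (hX.differentiable (by simp) p₀).hasFDerivAt
  have hYd := (hY.differentiable (by simp) p₀).hasFDerivAt
  have hcc : HasFDerivAt (fderiv ℝ c) (fderiv ℝ (fderiv ℝ c) p₀) p₀ :=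
    ((hc.fderiv_right (m := 1) (by
      rw [one_add_one_eq_two]; exact ENat.LEInfty.out)).differentiableAt (by simp)).hasFDerivAt
  have e1 : fderiv ℝ (fderiv ℝ c) p₀ (1, 0) (0, 1) =
      leftLiftDeriv I K (Y p₀) (X p₀) + fderiv ℝ X p₀ (1, 0) := by
    have h2 := hcc.clm_apply (hasFDerivAt_const ((0, 1) : ℝ × ℝ) p₀)
    have h3 := (hb.clm_apply hXd).congr_of_eventuallyEq hcX
    have h4 := congrArg (fun A : ℝ × ℝ →L[ℝ] E => A (1, 0)) (h2.unique h3)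
    simp only [_root_.add_apply, ContinuousLinearMap.comp_apply,
      ContinuousLinearMap.flip_apply, hb0, hY0] at h4
    simpa [add_comm] using h4
  have e2 : fderiv ℝ (fderiv ℝ c) p₀ (0, 1) (1, 0) =
      leftLiftDeriv I K (X p₀) (Y p₀) + fderiv ℝ Y p₀ (0, 1) := by
    have h2 := hcc.clm_apply (hasFDerivAt_const ((1, 0) : ℝ × ℝ) p₀)
    have h3 := (hb.clm_apply hYd).congr_of_eventuallyEq hcY
    have h4 := congrArg (fun A : ℝ × ℝ →L[ℝ] E => A (0, 1)) (h2.unique h3)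
    simp only [_root_.add_apply, ContinuousLinearMap.comp_apply,
      ContinuousLinearMap.flip_apply, hb0, hX0] at h4
    simpa [add_comm] using h4
  -- `e1` and `e2` differentiate `∂ₜ c = b X` in `s` and `∂ₛ c = b Y` in `t`
  have hsymm : fderiv ℝ (fderiv ℝ c) p₀ (1, 0) (0, 1) = fderiv ℝ (fderiv ℝ c) p₀ (0, 1) (1, 0) :=
    hc.isSymmSndFDerivAt (by
      rw [minSmoothness_of_isRCLikeNormedField]; exact ENat.LEInfty.out) (1, 0) (0, 1)
  have hXs : HasDerivAt (fun s' => X (s', t)) (fderiv ℝ X p₀ (1, 0)) s :=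
    HasFDerivAt.comp_hasDerivAt (x := s) (f := fun s' : ℝ => (s', t)) (l := X) hXd
      ((hasDerivAt_id s).prodMk (hasDerivAt_const s t))
  have hYt : HasDerivAt (fun t' => Y (s, t')) (fderiv ℝ Y p₀ (0, 1)) t :=
    HasFDerivAt.comp_hasDerivAt (x := t) (f := fun t' : ℝ => (s, t')) (l := Y) hYd
      ((hasDerivAt_const t s).prodMk (hasDerivAt_id t))
  have hlie := lie_eq_mfderiv_chartLeftLift (I := I) (K := K)
    (leftVelocity I (Γ s) t) (leftVelocity I (fun s' => Γ s' t) s)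
  rw [hlie]
  change HasDerivAt (fun s' => X (s', t)) (deriv (fun t' => Y (s, t')) t +
    (leftLiftDeriv I K (X p₀) (Y p₀) - leftLiftDeriv I K (Y p₀) (X p₀))) s
  rw [hYt.deriv]
  convert hXs using 1
  rw [e1, e2] at hsymm
  rw [← sub_eq_iff_eq_add'.2 hsymm]
  abel

/-- The Maurer-Cartan equation: for a smooth family `Γ s t` with left-trivialized velocities `X` in
`t` and `Y` in `s`, one has `∂ₛ X = ∂ₜ Y + [X, Y]`. -/
theorem hasDerivAt_leftVelocity_family {Γ : ℝ → ℝ → K}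
    (hΓ : ContMDiff 𝓘(ℝ, ℝ × ℝ) I ∞ (fun p : ℝ × ℝ => Γ p.1 p.2)) (s t : ℝ) :
    HasDerivAt (fun s' => leftVelocity I (Γ s') t)
      (deriv (fun t' => leftVelocity I (fun s' => Γ s' t') s) t +
        ⁅leftVelocity I (Γ s) t, leftVelocity I (fun s' => Γ s' t) s⁆) s := by
  -- translate the family so that it passes through `1`
  have hΔ : ContMDiff 𝓘(ℝ, ℝ × ℝ) I ∞ (fun p : ℝ × ℝ => (Γ s t)⁻¹ * Γ p.1 p.2) :=
    contMDiff_const.mul hΓ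
  have h := hasDerivAt_leftVelocity_family_of_eq_one (Γ := fun s' t' => (Γ s t)⁻¹ * Γ s' t') hΔ
    (s := s) (t := t) (inv_mul_cancel _)
  have e1 : ∀ s' t', leftVelocity I (fun u => (Γ s t)⁻¹ * Γ s' u) t'
      = leftVelocity I (Γ s') t' := fun s' t' =>
    leftVelocity_const_mul ((contMDiff_right_of_family hΓ s').mdifferentiableAt (by simp)) _
  have e2 : ∀ s' t', leftVelocity I (fun u => (Γ s t)⁻¹ * Γ u t') s'
      = leftVelocity I (fun u => Γ u t') s' := fun s' t' =>
    leftVelocity_const_mul (γ := fun u => Γ u t')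
      ((contMDiff_right_of_family (Γ := fun t s => Γ s t)
        (contMDiff_swap_of_family hΓ) t').mdifferentiableAt (by simp)) _
  simp only [e1, e2] at h
  exact h

end MaurerCartan

/-! ### Curves, families and variations with prescribed velocities -/

section Families

variable {E : Type*} [NormedAddCommGroup E] [NormedSpace ℝ E]
  {HE : Type*} [TopologicalSpace HE] {I : ModelWithCorners ℝ E HE}
  {K : Type*} [TopologicalSpace K] [ChartedSpace HE K] [Group K]

theorem leftVelocity_of_eq_one {γ : ℝ → K} {t : ℝ} (h : γ t = 1) :
    (leftVelocity I γ t : E) = velocity I γ t := by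
  have h2 : (fun x : K => (γ t)⁻¹ * x) = id := by ext; simp [h]
  unfold leftVelocity
  rw [h2, mfderiv_id]
  rfl

variable [LieGroup I ∞ K]

theorem leftVelocity_const (k : K) (t : ℝ) : leftVelocity I (fun _ => k) t = 0 := by
  refine leftVelocity_eq_of_leftLift_eq ?_
  rw [map_zero]
  exact (velocity_const k t).symm

variable [I.Boundaryless]

/-- The bracket measures the failure of the two left-trivialized velocities of a family to have
equal cross derivatives. -/
theorem lie_eq_sub_of_family {Γ : ℝ → ℝ → K}
    (hΓ : ContMDiff 𝓘(ℝ, ℝ × ℝ) I ∞ (fun p : ℝ × ℝ => Γ p.1 p.2)) {s t : ℝ} {X' Y' : E}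
    (hX : HasDerivAt (F := E) (fun s' => leftVelocity I (Γ s') t) X' s)
    (hY : HasDerivAt (F := E) (fun t' => leftVelocity I (fun s' => Γ s' t') s) Y' t) :
    ⁅leftVelocity I (Γ s) t, leftVelocity I (fun s' => Γ s' t) s⁆ = (X' - Y' : E) := by
  have h := hasDerivAt_leftVelocity_family hΓ s t
  have h2 : (deriv (F := E) (fun t' => leftVelocity I (fun s' => Γ s' t') s) t) = Y' := hY.deriv
  have h3 := HasDerivAt.unique (F := E) h hX
  have h4 : ∀ u v w : E, v = Y' → v + u = X' → u = X' - Y' := by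
    rintro u v w rfl rfl
    abel
  exact h4 _ _ 0 h2 h3

variable [FiniteDimensional ℝ E]

variable (I K) in
/-- There are smooth families through `1` with prescribed velocities there. -/
theorem exists_family (v w : GroupLieAlgebra I K) :
    ∃ Γ : ℝ → ℝ → K, ContMDiff 𝓘(ℝ, ℝ × ℝ) I ∞ (fun p : ℝ × ℝ => Γ p.1 p.2) ∧ Γ 0 0 = 1 ∧
      leftVelocity I (Γ 0) 0 = v ∧ leftVelocity I (fun s => Γ s 0) 0 = w := by
  obtain ⟨e, he, he0, hed⟩ := exists_contMDiff_hasMFDerivAt_id (I := I) (K := K)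
  let v' : E := v
  let w' : E := w
  have hcurve : ∀ u : E, (velocity I (fun t : ℝ => e (t • u)) 0 : E) = u := by
    intro u
    have h1 : HasFDerivAt (fun t : ℝ => t • u) ((1 : ℝ →L[ℝ] ℝ).smulRight u) 0 :=
      ((1 : ℝ →L[ℝ] ℝ).smulRight u).hasFDerivAt
    have h2 : HasMFDerivAt 𝓘(ℝ, E) I e ((0 : ℝ) • u) (ContinuousLinearMap.id ℝ E) := by
      rw [zero_smul]; exact hed
    have h3 := (h2.comp (0 : ℝ) h1.hasMFDerivAt).mfderiv
    have h4 := congrArg (fun A : ℝ →L[ℝ] E => A 1) h3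
    refine h4.trans ?_
    change ((1 : ℝ →L[ℝ] ℝ).smulRight u) 1 = u
    simp
  refine ⟨fun s t => e (t • v' + s • w'), ?_, by simpa using he0, ?_, ?_⟩
  · have h : ContDiff ℝ ∞ (fun p : ℝ × ℝ => p.2 • v' + p.1 • w') := by fun_prop
    exact he.comp h.contMDiff
  · simp only [zero_smul, add_zero]
    exact (leftVelocity_of_eq_one (γ := fun t : ℝ => e (t • v')) (by simpa using he0)).trans
      (hcurve v')
  · simp only [zero_smul, zero_add]
    exact (leftVelocity_of_eq_one (γ := fun t : ℝ => e (t • w')) (by simpa using he0)).trans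
      (hcurve w')

variable (I K) in
/-- There is a smooth curve through `1` with prescribed velocity there. -/
theorem exists_curve (v : GroupLieAlgebra I K) :
    ∃ γ : ℝ → K, ContMDiff 𝓘(ℝ, ℝ) I ∞ γ ∧ γ 0 = 1 ∧ leftVelocity I γ 0 = v := by
  obtain ⟨Γ, hΓ, h1, hv, -⟩ := exists_family I K v v
  exact ⟨Γ 0, contMDiff_right_of_family hΓ 0, h1, hv⟩

/-- Every smooth Lie algebra valued function that vanishes at the endpoints is the left-trivialized
velocity of a smooth variation with fixed endpoints. -/
theorem exists_variation {a b : ℝ} {γ : ℝ → K} (hγ : ContMDiff 𝓘(ℝ, ℝ) I ∞ γ)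
    {ζ : ℝ → E} (hζ : ContDiff ℝ ∞ ζ) (ha : ζ a = 0) (hb : ζ b = 0) :
    ∃ Γ : ℝ → ℝ → K, IsFixedEndpointVariation I a b γ Γ ∧
      ∀ t, leftVelocity I (fun s => Γ s t) 0 = ζ t := by
  obtain ⟨e, he, he0, hed⟩ := exists_contMDiff_hasMFDerivAt_id (I := I) (K := K)
  refine ⟨fun s t => γ t * e (s • ζ t), ⟨?_, ?_, ?_, ?_⟩, ?_⟩
  · have h1 : ContDiff ℝ ∞ (fun p : ℝ × ℝ => p.1 • ζ p.2) :=
      contDiff_fst.smul (hζ.comp contDiff_snd)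
    exact (hγ.comp (contDiff_snd (𝕜 := ℝ) (E := ℝ) (F := ℝ)).contMDiff).mul
      (he.comp h1.contMDiff)
  · intro t _; simp [he0]
  · intro s; simp [ha, he0]
  · intro s; simp [hb, he0]
  · intro t
    have h1 : HasFDerivAt (fun s : ℝ => s • ζ t) ((1 : ℝ →L[ℝ] ℝ).smulRight (ζ t)) 0 :=
      ((1 : ℝ →L[ℝ] ℝ).smulRight (ζ t)).hasFDerivAt
    have h2 : HasMFDerivAt 𝓘(ℝ, E) I e ((0 : ℝ) • ζ t) (ContinuousLinearMap.id ℝ E) := by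
      rw [zero_smul]; exact hed
    have h3 := h2.comp (0 : ℝ) h1.hasMFDerivAt
    have h4 := congrArg (fun A : ℝ →L[ℝ] E => A 1) h3.mfderiv
    have h5 := leftVelocity_const_mul (I := I) (γ := fun s : ℝ => e (s • ζ t)) (t := 0)
      h3.mdifferentiableAt (γ t)
    refine h5.trans ?_
    refine (leftVelocity_of_eq_one (γ := fun s : ℝ => e (s • ζ t)) (by simpa using he0)).trans ?_
    refine h4.trans ?_
    change ((1 : ℝ →L[ℝ] ℝ).smulRight (ζ t)) 1 = ζ t
    simp

end Families

/-! ### Left translations of the matched pair group -/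

namespace LieMatchedPair

section Basic

variable {E : Type*} [NormedAddCommGroup E] [NormedSpace ℝ E]
  {HE : Type*} [TopologicalSpace HE] {I : ModelWithCorners ℝ E HE}
  {F : Type*} [NormedAddCommGroup F] [NormedSpace ℝ F]
  {HF : Type*} [TopologicalSpace HF] {J : ModelWithCorners ℝ F HF}
  {G : Type*} [TopologicalSpace G] [ChartedSpace HE G] [Group G]
  {H : Type*} [TopologicalSpace H] [ChartedSpace HF H] [Group H]
  (P : LieMatchedPair I J G H)

theorem contMDiff_pt {E₀ : Type*} [NormedAddCommGroup E₀] [NormedSpace ℝ E₀]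
    {H₀ : Type*} [TopologicalSpace H₀] {I₀ : ModelWithCorners ℝ E₀ H₀}
    {N : Type*} [TopologicalSpace N] [ChartedSpace H₀ N] {g : N → G} {h : N → H}
    (hg : ContMDiff I₀ I ∞ g) (hh : ContMDiff I₀ J ∞ h) :
    ContMDiff I₀ (I.prod J) ∞ (fun x => P.pt (g x) (h x)) :=
  hg.prodMk hh

theorem contMDiff_rho_right (h : H) : ContMDiff I I ∞ (fun g : G => P.rho h g) :=
  P.contMDiff_rho.comp (contMDiff_const.prodMk contMDiff_id)

theorem contMDiff_sigma_right (h : H) : ContMDiff I J ∞ (fun g : G => P.sigma h g) :=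
  P.contMDiff_sigma.comp (contMDiff_const.prodMk contMDiff_id)

theorem contMDiff_sigma_left (g : G) : ContMDiff J J ∞ (fun h : H => P.sigma h g) :=
  P.contMDiff_sigma.comp (contMDiff_id.prodMk contMDiff_const)

theorem velocity_pt {g : ℝ → G} {h : ℝ → H} {t : ℝ} (hg : MDifferentiableAt 𝓘(ℝ, ℝ) I g t)
    (hh : MDifferentiableAt 𝓘(ℝ, ℝ) J h t) :
    (velocity (I.prod J) (fun u => P.pt (g u) (h u)) t : E × F) =
      (velocity I g t, velocity J h t) :=
  congrArg (fun A : ℝ →L[ℝ] E × F => A 1) (mfderiv_prodMk hg hh)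

theorem rhoLie_one : P.rhoLie 1 = ContinuousLinearMap.id ℝ E := by
  have h : (fun g : G => P.rho 1 g) = id := funext P.one_rho
  unfold rhoLie
  rw [h]
  exact mfderiv_id

theorem sigmaLift_one (ξ : GroupLieAlgebra I G) : (P.sigmaLift 1 ξ : F) = 0 := by
  have h : (fun g : G => P.sigma 1 g) = fun _ => 1 := funext P.one_sigma
  unfold sigmaLift
  rw [h, mfderiv_const]
  rfl

variable [LieGroup I ∞ G]

theorem leftRhoLift_apply (g : G) (h : H) (ξ : GroupLieAlgebra I G) :
    (P.leftRhoLift g h ξ : E) = leftLift I g (P.rhoLie h ξ) :=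
  mfderiv_comp_apply_of_eq (I := I) (I' := I) (I'' := I) (x := (1 : G)) (y := (1 : G))
    (f := fun x : G => P.rho h x) (g := fun x : G => g * x)
    (mdifferentiableAt_mul_left_of_lieGroup _ _)
    ((P.contMDiff_rho_right h).mdifferentiableAt (by simp)) (P.rho_one h) ξ

variable [LieGroup J ∞ H]

/-- The differential at the identity of the left translation by `(g, h)`. -/
theorem leftLift_pt (g : G) (h : H) (ξ : GroupLieAlgebra I G) (η : GroupLieAlgebra J H) :
    (leftLift (I.prod J) (P.pt g h) (P.lieMk ξ η) : E × F) =
      (P.leftRhoLift g h ξ, (P.sigmaLift h ξ + leftLift J h η : F)) := by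
  have h1 : ContMDiff I I ∞ (fun x : G => g * P.rho h x) :=
    (contMDiff_mul_left (I := I) (n := ∞) (a := g)).comp (P.contMDiff_rho_right h)
  have h2 : ContMDiff (I.prod J) J ∞ (fun x : G × H => P.sigma h x.1 * x.2) :=
    ((P.contMDiff_sigma_right h).comp contMDiff_fst).mul contMDiff_snd
  have h1' : ContMDiff (I.prod J) I ∞ (fun x : G × H => g * P.rho h x.1) :=
    h1.comp contMDiff_fst
  have e := congrArg (fun A : E × F →L[ℝ] E × F => A (ξ, η))
    (mfderiv_prodMk (h1'.mdifferentiableAt (x := ((1, 1) : G × H)) (by simp))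
      (h2.mdifferentiableAt (x := ((1, 1) : G × H)) (by simp)))
  refine Eq.trans e ?_
  refine Prod.ext ?_ ?_
  · have h3 := mfderiv_comp_apply (I' := I) ((1, 1) : G × H)
      (h1.mdifferentiableAt (x := (1 : G)) (by simp))
      (mdifferentiableAt_fst (I := I) (I' := J) (x := ((1, 1) : G × H))) ((ξ, η) : E × F)
    rw [mfderiv_fst] at h3
    exact h3
  · have h3 := mfderiv_prod_eq_add_apply (v := ((ξ, η) : E × F))
      (h2.mdifferentiableAt (x := ((1, 1) : G × H)) (by simp))
    have e1 : (fun z : G => P.sigma h z * 1) = fun z => P.sigma h z := by ext; simp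
    have e2 : (fun z : H => P.sigma h 1 * z) = fun z => h * z := by ext; rw [P.sigma_one]
    have f1 := congrArg (fun f : G → H => (mfderiv I J f 1 ξ : F)) e1
    have f2 := congrArg (fun f : H → H => (mfderiv J J f 1 η : F)) e2
    exact h3.trans (congrArg₂ (fun u v : F => u + v) f1 f2)

/-- The components `(ξ, η)` of the left-trivialized velocity of a path `(g, h)` in `G ⋈ H` are
characterized by `g' = T_e (L_g ∘ ρ_h) ξ` and `h' = T_e σ_h ξ + T_e L_h η`. -/
theorem leftVelocity_pt_eq_iff {g : ℝ → G} {h : ℝ → H} {t : ℝ}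
    (hg : MDifferentiableAt 𝓘(ℝ, ℝ) I g t) (hh : MDifferentiableAt 𝓘(ℝ, ℝ) J h t)
    (ξ : GroupLieAlgebra I G) (η : GroupLieAlgebra J H) :
    leftVelocity (I.prod J) (fun u => P.pt (g u) (h u)) t = P.lieMk ξ η ↔
      velocity I g t = P.leftRhoLift (g t) (h t) ξ ∧
      velocity J h t = P.sigmaLift (h t) ξ + leftLift J (h t) η := by
  have hv := P.velocity_pt hg hh
  have hl := P.leftLift_pt (g t) (h t) ξ η
  constructor
  · intro H0
    have h1 := leftLift_leftVelocity (I := I.prod J) (fun u => P.pt (g u) (h u)) t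
    rw [H0] at h1
    have h2 := hl.symm.trans (h1.trans hv)
    exact ⟨(congrArg Prod.fst h2).symm, (congrArg Prod.snd h2).symm⟩
  · rintro ⟨h1, h2⟩
    refine leftVelocity_eq_of_leftLift_eq ?_
    refine hl.trans (Eq.trans ?_ hv.symm)
    exact Prod.ext h1.symm h2.symm

/-- The cotangent lift of left translation is the transpose of `leftLift_pt`. -/
theorem coLeftLift_pt (g : G) (h : H) (α : CotangentSpace I g) (β : CotangentSpace J h) :
    coLeftLift (I.prod J) (P.pt g h) (P.coMk g h α β) =
      P.lieCoMk (P.coRho (coLeftLift I g α) h + P.coSigmaLift h β) (coLeftLift J h β) := by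
  refine ContinuousLinearMap.ext fun v => ?_
  obtain ⟨ξ, η⟩ := v
  have h1 := congrArg (fun w : E × F => (P.coMk g h α β : E × F →L[ℝ] ℝ) w)
    (P.leftLift_pt g h ξ η)
  refine h1.trans ?_
  change α (P.leftRhoLift g h ξ) + β (P.sigmaLift h ξ + leftLift J h η) =
    (α (leftLift I g (P.rhoLie h ξ)) + β (P.sigmaLift h ξ)) + β (leftLift J h η)
  have h2 : α (P.leftRhoLift g h ξ) = α (leftLift I g (P.rhoLie h ξ)) :=
    congrArg α (P.leftRhoLift_apply g h ξ)
  rw [h2, map_add, add_assoc]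

end Basic

section Infinitesimal

variable {E : Type*} [NormedAddCommGroup E] [NormedSpace ℝ E]
  {HE : Type*} [TopologicalSpace HE] {I : ModelWithCorners ℝ E HE}
  {F : Type*} [NormedAddCommGroup F] [NormedSpace ℝ F]
  {HF : Type*} [TopologicalSpace HF] {J : ModelWithCorners ℝ F HF}
  {G : Type*} [TopologicalSpace G] [ChartedSpace HE G] [Group G]
  {H : Type*} [TopologicalSpace H] [ChartedSpace HF H] [Group H]
  (P : LieMatchedPair I J G H) [LieGroup I ∞ G] [LieGroup J ∞ H]

/-! ### The infinitesimal actions -/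

theorem hasMFDerivAt_rhoLie :
    HasMFDerivAt (M' := E →L[ℝ] E) J 𝓘(ℝ, E →L[ℝ] E) (fun h : H => P.rhoLie h) 1 P.infRho := by
  have h := contMDiffAt_mfderiv_of_const (I := I) (I' := I) (J := J) (f := P.rho) (p := 1)
    (q := 1) (x₀ := 1) P.contMDiff_rho.contMDiffAt P.rho_one
  exact (h.mdifferentiableAt (by simp)).hasMFDerivAt

theorem hasMFDerivAt_sigmaLie :
    HasMFDerivAt (M' := F →L[ℝ] F) I 𝓘(ℝ, F →L[ℝ] F) (fun g : G => P.sigmaLie g) 1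
      P.infSigma := by
  have h0 : ContMDiff (I.prod J) J ∞ (fun z : G × H => P.sigma z.2 z.1) :=
    P.contMDiff_sigma.comp (contMDiff_snd.prodMk contMDiff_fst)
  have h := contMDiffAt_mfderiv_of_const (I := J) (I' := J) (J := I)
    (f := fun g h => P.sigma h g) (p := 1) (q := 1) (x₀ := 1) h0.contMDiffAt P.one_sigma
  exact (h.mdifferentiableAt (by simp)).hasMFDerivAt

theorem bMap_apply (ξ : GroupLieAlgebra I G) (η : GroupLieAlgebra J H) :
    P.bMap ξ η = P.infRho η ξ := by
  let ev : (E →L[ℝ] E) →L[ℝ] E := ContinuousLinearMap.apply ℝ E (ξ : E)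
  have h := (ev.hasFDerivAt (x := (P.rhoLie 1 : E →L[ℝ] E))).hasMFDerivAt.comp (1 : H)
    P.hasMFDerivAt_rhoLie
  exact congrArg (fun A : F →L[ℝ] E => A η) h.mfderiv

theorem aMap_apply (η : GroupLieAlgebra J H) (ξ : GroupLieAlgebra I G) :
    P.aMap η ξ = P.infSigma ξ η := by
  let ev : (F →L[ℝ] F) →L[ℝ] F := ContinuousLinearMap.apply ℝ F (η : F)
  have h := (ev.hasFDerivAt (x := (P.sigmaLie 1 : F →L[ℝ] F))).hasMFDerivAt.comp (1 : G)
    P.hasMFDerivAt_sigmaLie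
  exact congrArg (fun A : E →L[ℝ] F => A ξ) h.mfderiv

theorem hasDerivAt_rhoLie {h : ℝ → H} {s : ℝ} (hh : MDifferentiableAt 𝓘(ℝ, ℝ) J h s)
    (h1 : h s = 1) :
    HasDerivAt (F := E →L[ℝ] E) (fun u => P.rhoLie (h u)) (P.infRho (velocity J h s)) s := by
  have h2 := P.hasMFDerivAt_rhoLie
  rw [← h1] at h2
  let R : H → E →L[ℝ] E := fun k => P.rhoLie k
  let D : F →L[ℝ] E →L[ℝ] E := P.infRho
  let A : ℝ →L[ℝ] F := mfderiv 𝓘(ℝ, ℝ) J h s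
  have h3 : HasFDerivAt (fun u => R (h u)) (D.comp A) s :=
    hasMFDerivAt_iff_hasFDerivAt.1 (h2.comp s hh.hasMFDerivAt)
  exact h3.hasDerivAt

theorem hasDerivAt_sigmaLie {g : ℝ → G} {t : ℝ} (hg : MDifferentiableAt 𝓘(ℝ, ℝ) I g t)
    (h1 : g t = 1) :
    HasDerivAt (F := F →L[ℝ] F) (fun u => P.sigmaLie (g u)) (P.infSigma (velocity I g t)) t := by
  have h2 := P.hasMFDerivAt_sigmaLie
  rw [← h1] at h2
  let S : G → F →L[ℝ] F := fun k => P.sigmaLie k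
  let D : E →L[ℝ] F →L[ℝ] F := P.infSigma
  let A : ℝ →L[ℝ] E := mfderiv 𝓘(ℝ, ℝ) I g t
  have h3 : HasFDerivAt (fun u => S (g u)) (D.comp A) t :=
    hasMFDerivAt_iff_hasFDerivAt.1 (h2.comp t hg.hasMFDerivAt)
  exact h3.hasDerivAt

/-! ### The bracket of the matched pair Lie algebra -/

theorem leftVelocity_pt_one_right {g : ℝ → G} {t : ℝ} (hg : MDifferentiableAt 𝓘(ℝ, ℝ) I g t) :
    leftVelocity (I.prod J) (fun u => P.pt (g u) 1) t = P.lieMk (leftVelocity I g t) 0 := by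
  refine (P.leftVelocity_pt_eq_iff (h := fun _ => 1) hg mdifferentiableAt_const _ _).2 ⟨?_, ?_⟩
  · have h1 := P.leftRhoLift_apply (g t) 1 (leftVelocity I g t)
    rw [P.rhoLie_one] at h1
    exact (h1.trans (leftLift_leftVelocity g t)).symm
  · rw [map_zero, add_zero]
    exact (velocity_const (I := J) (1 : H) t).trans (P.sigmaLift_one _).symm

theorem leftVelocity_pt_const_left (g : G) {h : ℝ → H} {t : ℝ}
    (hh : MDifferentiableAt 𝓘(ℝ, ℝ) J h t) :
    leftVelocity (I.prod J) (fun u => P.pt g (h u)) t = P.lieMk 0 (leftVelocity J h t) := by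
  refine (P.leftVelocity_pt_eq_iff (g := fun _ => g) mdifferentiableAt_const hh _ _).2 ⟨?_, ?_⟩
  · rw [map_zero]
    exact velocity_const (I := I) g t
  · rw [map_zero, zero_add, leftLift_leftVelocity]

variable [I.Boundaryless] [J.Boundaryless]

/-- `𝔤` is a subalgebra of `𝔤 ⋈ 𝔥`: a family in `G` and its image `(g, e)` in `G ⋈ H` have the same
left-trivialized velocities. -/
theorem lie_lieMk_left [FiniteDimensional ℝ E] (ξ₁ ξ₂ : GroupLieAlgebra I G) :
    ⁅P.lieMk ξ₁ 0, P.lieMk ξ₂ 0⁆ = P.lieMk ⁅ξ₁, ξ₂⁆ 0 := by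
  obtain ⟨Γ, hΓ, -, hv, hw⟩ := exists_family I G ξ₁ ξ₂
  have hΓ' := contMDiff_swap_of_family hΓ
  have hr : ∀ s t, MDifferentiableAt 𝓘(ℝ, ℝ) I (Γ s) t := fun s t =>
    (contMDiff_right_of_family hΓ s).mdifferentiableAt (by simp)
  have hl : ∀ s t, MDifferentiableAt 𝓘(ℝ, ℝ) I (fun s' => Γ s' t) s := fun s t =>
    (contMDiff_right_of_family (Γ := fun t s => Γ s t) hΓ' t).mdifferentiableAt (by simp)
  have hX : HasDerivAt (F := E) (fun s => leftVelocity I (Γ s) 0) _ 0 :=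
    (((contDiff_leftVelocity hΓ).comp (contDiff_prodMk_left (0 : ℝ))).differentiable
      (by simp) 0).hasDerivAt
  have hY : HasDerivAt (F := E) (fun t => leftVelocity I (fun s' => Γ s' t) 0) _ 0 :=
    (((contDiff_leftVelocity (Γ := fun t s => Γ s t) hΓ').comp
      (contDiff_prodMk_left (0 : ℝ))).differentiable (by simp) 0).hasDerivAt
  have e := lie_eq_sub_of_family hΓ hX hY
  have hX2 := hX.prodMk (hasDerivAt_const (0 : ℝ) (0 : F))
  have hY2 := hY.prodMk (hasDerivAt_const (0 : ℝ) (0 : F))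
  have e2 := lie_eq_sub_of_family (I := I.prod J) (E := E × F) (Γ := fun s t => P.pt (Γ s t) 1)
    (P.contMDiff_pt hΓ contMDiff_const) (s := 0) (t := 0)
    (hX2.congr_of_eventuallyEq (.of_forall fun s => P.leftVelocity_pt_one_right (hr s 0)))
    (hY2.congr_of_eventuallyEq (.of_forall fun t => P.leftVelocity_pt_one_right (hl 0 t)))
  rw [P.leftVelocity_pt_one_right (hr 0 0), P.leftVelocity_pt_one_right (hl 0 0), hv, hw] at e2
  rw [hv, hw] at e
  rw [e]
  refine e2.trans ?_
  exact Prod.ext rfl (sub_zero (0 : F))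

/-- `𝔥` is a subalgebra of `𝔤 ⋈ 𝔥`, by the families `(e, h)`. -/
theorem lie_lieMk_right [FiniteDimensional ℝ F] (η₁ η₂ : GroupLieAlgebra J H) :
    ⁅P.lieMk 0 η₁, P.lieMk 0 η₂⁆ = P.lieMk 0 ⁅η₁, η₂⁆ := by
  obtain ⟨Γ, hΓ, -, hv, hw⟩ := exists_family J H η₁ η₂
  have hΓ' := contMDiff_swap_of_family hΓ
  have hr : ∀ s t, MDifferentiableAt 𝓘(ℝ, ℝ) J (Γ s) t := fun s t =>
    (contMDiff_right_of_family hΓ s).mdifferentiableAt (by simp)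
  have hl : ∀ s t, MDifferentiableAt 𝓘(ℝ, ℝ) J (fun s' => Γ s' t) s := fun s t =>
    (contMDiff_right_of_family (Γ := fun t s => Γ s t) hΓ' t).mdifferentiableAt (by simp)
  have hX : HasDerivAt (F := F) (fun s => leftVelocity J (Γ s) 0) _ 0 :=
    (((contDiff_leftVelocity hΓ).comp (contDiff_prodMk_left (0 : ℝ))).differentiable
      (by simp) 0).hasDerivAt
  have hY : HasDerivAt (F := F) (fun t => leftVelocity J (fun s' => Γ s' t) 0) _ 0 :=
    (((contDiff_leftVelocity (Γ := fun t s => Γ s t) hΓ').comp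
      (contDiff_prodMk_left (0 : ℝ))).differentiable (by simp) 0).hasDerivAt
  have e := lie_eq_sub_of_family hΓ hX hY
  have hX2 := (hasDerivAt_const (0 : ℝ) (0 : E)).prodMk hX
  have hY2 := (hasDerivAt_const (0 : ℝ) (0 : E)).prodMk hY
  have e2 := lie_eq_sub_of_family (I := I.prod J) (E := E × F) (Γ := fun s t => P.pt 1 (Γ s t))
    (P.contMDiff_pt contMDiff_const hΓ) (s := 0) (t := 0)
    (hX2.congr_of_eventuallyEq (.of_forall fun s => P.leftVelocity_pt_const_left 1 (hr s 0)))
    (hY2.congr_of_eventuallyEq (.of_forall fun t => P.leftVelocity_pt_const_left 1 (hl 0 t)))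
  rw [P.leftVelocity_pt_const_left 1 (hr 0 0), P.leftVelocity_pt_const_left 1 (hl 0 0),
    hv, hw] at e2
  rw [hv, hw] at e
  rw [e]
  refine e2.trans ?_
  exact Prod.ext (sub_zero (0 : E)) rfl

variable [FiniteDimensional ℝ E] [FiniteDimensional ℝ F]

/-- The `𝔤`-component of the mixed bracket, from the family `(g t, h s)`: its `t`-velocity `a s`
satisfies `h s ▷ a s = ξ`. -/
theorem lieFst_lie_lieMk (ξ : GroupLieAlgebra I G) (η : GroupLieAlgebra J H) :
    P.lieFst ⁅P.lieMk ξ 0, P.lieMk 0 η⁆ = -P.infRho η ξ := by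
  obtain ⟨g, hg, hg0, hgv⟩ := exists_curve I G ξ
  obtain ⟨h, hh, hh0, hhv⟩ := exists_curve J H η
  have hgd : ∀ t, MDifferentiableAt 𝓘(ℝ, ℝ) I g t := fun t => hg.mdifferentiableAt (by simp)
  have hhd : ∀ t, MDifferentiableAt 𝓘(ℝ, ℝ) J h t := fun t => hh.mdifferentiableAt (by simp)
  have hΓ : ContMDiff 𝓘(ℝ, ℝ × ℝ) (I.prod J) ∞ (fun p : ℝ × ℝ => P.pt (g p.2) (h p.1)) :=
    P.contMDiff_pt (hg.comp (contDiff_snd (𝕜 := ℝ) (E := ℝ) (F := ℝ)).contMDiff)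
      (hh.comp (contDiff_fst (𝕜 := ℝ) (E := ℝ) (F := ℝ)).contMDiff)
  let X : ℝ → E × F := fun s => leftVelocity (I.prod J) (fun t => P.pt (g t) (h s)) 0
  have hX : HasDerivAt X (deriv X 0) 0 :=
    (((contDiff_leftVelocity (Γ := fun s t => P.pt (g t) (h s)) hΓ).comp
      (contDiff_prodMk_left (0 : ℝ))).differentiable (by simp) 0).hasDerivAt
  have hY : HasDerivAt (F := E × F)
      (fun t => leftVelocity (I.prod J) (fun s => P.pt (g t) (h s)) 0) 0 0 := by
    refine (hasDerivAt_const (0 : ℝ) ((0, (leftVelocity J h 0 : F)) : E × F)).congr_of_eventuallyEq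
      (.of_forall fun t => ?_)
    exact P.leftVelocity_pt_const_left (g t) (hhd 0)
  have e := lie_eq_sub_of_family (I := I.prod J) (E := E × F)
    (Γ := fun s t => P.pt (g t) (h s)) hΓ hX hY
  have hX0 : leftVelocity (I.prod J) (fun t => P.pt (g t) (h 0)) 0 = P.lieMk ξ 0 := by
    rw [hh0, P.leftVelocity_pt_one_right (hgd 0), hgv]
  have hY0 : leftVelocity (I.prod J) (fun s => P.pt (g 0) (h s)) 0 = P.lieMk 0 η := by
    rw [P.leftVelocity_pt_const_left _ (hhd 0), hhv]
  rw [hX0, hY0] at e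
  -- the velocity equation `h s ▷ (X s).1 = ξ`
  have hXeq : ∀ s, (P.rhoLie (h s) : E →L[ℝ] E) (X s).1 = ξ := by
    intro s
    have h1 := ((P.leftVelocity_pt_eq_iff (h := fun _ => h s) (hgd 0) mdifferentiableAt_const
      (X s).1 (X s).2).1 rfl).1
    have h2 := h1.trans (P.leftRhoLift_apply (g 0) (h s) (X s).1)
    have h3 := (leftLift_leftVelocity (I := I) g 0).trans h2
    have h4 := congrArg (fun v => (mfderiv I I (fun x : G => (g 0)⁻¹ * x) (g 0) v : E)) h3
    have h5 := (mfderiv_inv_mul_leftLift (I := I) (g 0) (leftVelocity I g 0)).symm.trans (h4.trans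
      (mfderiv_inv_mul_leftLift (I := I) (g 0) (P.rhoLie (h s) (X s).1)))
    rw [hgv] at h5
    exact h5.symm
  let R : H → E →L[ℝ] E := fun k => P.rhoLie k
  let D : F →L[ℝ] E →L[ℝ] E := P.infRho
  let ξ' : E := ξ
  let w : F := velocity J h 0
  have hr : HasDerivAt (fun s => R (h s)) (D w) 0 := P.hasDerivAt_rhoLie (hhd 0) hh0
  have hX1 : HasDerivAt (fun s => (X s).1) (deriv X 0).1 0 := hX.fst
  have h6 := hr.clm_apply hX1
  have h7 : HasDerivAt (fun s => R (h s) (X s).1) 0 0 := by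
    have : (fun s => R (h s) (X s).1) = fun _ => ξ' := funext hXeq
    rw [this]
    exact hasDerivAt_const _ _
  have h8 := h6.unique h7
  have h9 : w = (η : F) := (leftVelocity_of_eq_one hh0).symm.trans hhv
  have h10 : (X 0).1 = ξ' := congrArg Prod.fst (show X 0 = ((ξ, 0) : E × F) from hX0)
  have hR1 : R (h 0) = ContinuousLinearMap.id ℝ E := by
    rw [hh0]; exact P.rhoLie_one
  have h11 : D (η : F) ξ' + (deriv X 0).1 = 0 := by
    rw [hR1, h10, h9] at h8
    exact h8
  have h12 : P.lieFst ⁅P.lieMk ξ 0, P.lieMk 0 η⁆ = ((deriv X 0).1 - 0 : E) :=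
    congrArg (fun v : E × F => v.1) e
  rw [h12]
  have h13 : ∀ u v : E, u + v = 0 → v - 0 = -u := fun u v huv => by
    rw [sub_zero]; exact eq_neg_of_add_eq_zero_right huv
  exact h13 _ _ h11

/-- The `𝔥`-component of the mixed bracket, from the family `(e, h s) (g t, e)`: its `t`-velocity is
constant in `s`, and its `s`-velocity at `s = 0` has the component `η ◁ g t`. -/
theorem lieSnd_lie_lieMk (ξ : GroupLieAlgebra I G) (η : GroupLieAlgebra J H) :
    P.lieSnd ⁅P.lieMk ξ 0, P.lieMk 0 η⁆ = -P.infSigma ξ η := by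
  obtain ⟨g, hg, hg0, hgv⟩ := exists_curve I G ξ
  obtain ⟨h, hh, hh0, hhv⟩ := exists_curve J H η
  have hgd : ∀ t, MDifferentiableAt 𝓘(ℝ, ℝ) I g t := fun t => hg.mdifferentiableAt (by simp)
  have hhd : ∀ t, MDifferentiableAt 𝓘(ℝ, ℝ) J h t := fun t => hh.mdifferentiableAt (by simp)
  let Γ : ℝ → ℝ → P.Bicrossed := fun s t => P.pt 1 (h s) * P.pt (g t) 1
  have hΓeq : ∀ s t, Γ s t = P.pt (P.rho (h s) (g t)) (P.sigma (h s) (g t)) := by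
    intro s t
    refine Prod.ext ?_ ?_
    · exact one_mul _
    · exact mul_one _
  have hg2 : ContMDiff 𝓘(ℝ, ℝ × ℝ) I ∞ (fun p : ℝ × ℝ => g p.2) :=
    hg.comp (contDiff_snd (𝕜 := ℝ) (E := ℝ) (F := ℝ)).contMDiff
  have hh2 : ContMDiff 𝓘(ℝ, ℝ × ℝ) J ∞ (fun p : ℝ × ℝ => h p.1) :=
    hh.comp (contDiff_fst (𝕜 := ℝ) (E := ℝ) (F := ℝ)).contMDiff
  have hΓ : ContMDiff 𝓘(ℝ, ℝ × ℝ) (I.prod J) ∞ (fun p : ℝ × ℝ => Γ p.1 p.2) :=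
    (P.contMDiff_pt contMDiff_const hh2).mul (P.contMDiff_pt hg2 contMDiff_const)
  have hΓ' := contMDiff_swap_of_family hΓ
  have hX0 : ∀ s, leftVelocity (I.prod J) (Γ s) 0 = P.lieMk ξ 0 := by
    intro s
    have hm : MDifferentiableAt 𝓘(ℝ, ℝ) (I.prod J) (fun t => P.pt (g t) 1) 0 :=
      (P.contMDiff_pt hg contMDiff_const).mdifferentiableAt (by simp)
    refine (leftVelocity_const_mul hm (P.pt 1 (h s))).trans ?_
    rw [P.leftVelocity_pt_one_right (hgd 0), hgv]
  have hX : HasDerivAt (F := E × F) (fun s => leftVelocity (I.prod J) (Γ s) 0) 0 0 :=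
    (hasDerivAt_const (0 : ℝ) ((ξ, 0) : E × F)).congr_of_eventuallyEq (.of_forall hX0)
  let Y : ℝ → E × F := fun t => leftVelocity (I.prod J) (fun s => Γ s t) 0
  have hY : HasDerivAt Y (deriv Y 0) 0 :=
    (((contDiff_leftVelocity (Γ := fun t s => Γ s t) hΓ').comp
      (contDiff_prodMk_left (0 : ℝ))).differentiable (by simp) 0).hasDerivAt
  have hY0 : leftVelocity (I.prod J) (fun s => Γ s 0) 0 = P.lieMk 0 η := by
    have h1 : (fun s => Γ s 0) = fun s => P.pt 1 (h s) := by
      funext s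
      rw [hΓeq, hg0, P.rho_one, P.sigma_one]
    rw [h1, P.leftVelocity_pt_const_left _ (hhd 0), hhv]
  have e := lie_eq_sub_of_family hΓ hX hY
  rw [hX0, hY0] at e
  have h9 : (velocity J h 0 : F) = η := (leftVelocity_of_eq_one hh0).symm.trans hhv
  have hYeq : ∀ t, (Y t).2 = (P.sigmaLie (g t) : F →L[ℝ] F) η := by
    intro t
    have hs1 : P.sigma (h 0) (g t) = 1 := by rw [hh0, P.one_sigma]
    have hρ : ContMDiff 𝓘(ℝ, ℝ) I ∞ (fun s => P.rho (h s) (g t)) :=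
      P.contMDiff_rho.comp (hh.prodMk contMDiff_const)
    have hσ : ContMDiff 𝓘(ℝ, ℝ) J ∞ (fun s => P.sigma (h s) (g t)) :=
      P.contMDiff_sigma.comp (hh.prodMk contMDiff_const)
    have h0 : leftVelocity (I.prod J)
        (fun s => P.pt (P.rho (h s) (g t)) (P.sigma (h s) (g t))) 0 = P.lieMk (Y t).1 (Y t).2 := by
      have : (fun s => Γ s t) = fun s => P.pt (P.rho (h s) (g t)) (P.sigma (h s) (g t)) :=
        funext fun s => hΓeq s t
      rw [← this]
      rfl
    have h1 := ((P.leftVelocity_pt_eq_iff (hρ.mdifferentiableAt (by simp))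
      (hσ.mdifferentiableAt (by simp)) _ _).1 h0).2
    have h2 : ∀ k : H, k = 1 →
        ((P.sigmaLift k (Y t).1 : F) + (leftLift J k (Y t).2 : F) : F) = (Y t).2 := by
      rintro k rfl
      have u1 := P.sigmaLift_one (Y t).1
      have u2 := leftLift_one (I := J) (K := H) (Y t).2
      exact (congrArg₂ (fun u v : F => u + v) u1 u2).trans (zero_add _)
    have h3 := h1.trans (h2 _ hs1)
    have h4 := mfderiv_comp_apply_of_eq (I := 𝓘(ℝ, ℝ)) (I' := J) (I'' := J) (x := (0 : ℝ))
      (y := (1 : H)) (f := h) (g := fun k : H => P.sigma k (g t))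
      ((P.contMDiff_sigma_left (g t)).mdifferentiableAt (by simp)) (hhd 0) hh0 (1 : ℝ)
    have h5 := congrArg (fun v : F => (P.sigmaLie (g t) : F →L[ℝ] F) v) h9
    exact h3.symm.trans (Eq.trans h4 h5)
  let S : G → F →L[ℝ] F := fun k => P.sigmaLie k
  let D : E →L[ℝ] F →L[ℝ] F := P.infSigma
  let η' : F := η
  let w : E := velocity I g 0
  have hr : HasDerivAt (fun t => S (g t)) (D w) 0 := P.hasDerivAt_sigmaLie (hgd 0) hg0
  have h6 := hr.clm_apply (hasDerivAt_const (0 : ℝ) η')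
  have h7 : HasDerivAt (fun t => S (g t) η') (deriv Y 0).2 0 := by
    have : (fun t => S (g t) η') = fun t => (Y t).2 := funext fun t => (hYeq t).symm
    rw [this]
    exact hY.snd
  have h8 := h6.unique h7
  have h10 : w = (ξ : E) := (leftVelocity_of_eq_one hg0).symm.trans hgv
  have h11 : D (ξ : E) η' = (deriv Y 0).2 := by
    rw [map_zero, add_zero, h10] at h8
    exact h8
  have h12 : P.lieSnd ⁅P.lieMk ξ 0, P.lieMk 0 η⁆ = (0 - (deriv Y 0).2 : F) :=
    congrArg (fun v : E × F => v.2) e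
  rw [h12]
  have h13 : ∀ u v : F, u = v → 0 - v = -u := fun u v huv => by
    rw [zero_sub, huv]
  exact h13 _ _ h11

end Infinitesimal

/-! ### The coadjoint action and the variations of a path in the matched pair group -/

section Variations

variable {E : Type*} [NormedAddCommGroup E] [NormedSpace ℝ E] [FiniteDimensional ℝ E]
  {HE : Type*} [TopologicalSpace HE] {I : ModelWithCorners ℝ E HE} [I.Boundaryless]
  {F : Type*} [NormedAddCommGroup F] [NormedSpace ℝ F] [FiniteDimensional ℝ F]
  {HF : Type*} [TopologicalSpace HF] {J : ModelWithCorners ℝ F HF} [J.Boundaryless]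
  {G : Type*} [TopologicalSpace G] [ChartedSpace HE G] [Group G] [LieGroup I ∞ G]
  {H : Type*} [TopologicalSpace H] [ChartedSpace HF H] [Group H] [LieGroup J ∞ H]
  (P : LieMatchedPair I J G H)

theorem lie_lieMk (ξ₁ ξ₂ : GroupLieAlgebra I G) (η₁ η₂ : GroupLieAlgebra J H) :
    ⁅P.lieMk ξ₁ η₁, P.lieMk ξ₂ η₂⁆ =
      P.lieMk (⁅ξ₁, ξ₂⁆ + P.infRho η₁ ξ₂ - P.infRho η₂ ξ₁)
        (⁅η₁, η₂⁆ + P.infSigma ξ₂ η₁ - P.infSigma ξ₁ η₂) := by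
  have : CompleteSpace (E × F) := FiniteDimensional.complete ℝ (E × F)
  have : LieGroup (I.prod J) (minSmoothness ℝ 3) P.Bicrossed :=
    LieGroup.of_le (n := ∞) (by
      rw [minSmoothness_of_isRCLikeNormedField]
      exact ENat.LEInfty.out)
  have hsplit : ∀ (ξ : GroupLieAlgebra I G) (η : GroupLieAlgebra J H),
      P.lieMk ξ η = P.lieMk ξ 0 + P.lieMk 0 η := fun ξ η =>
    (Prod.ext (add_zero (ξ : E)).symm (zero_add (η : F)).symm : ((ξ, η) : E × F) = (ξ, 0) + (0, η))
  have hmix : ∀ (ξ : GroupLieAlgebra I G) (η : GroupLieAlgebra J H),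
      ⁅P.lieMk ξ 0, P.lieMk 0 η⁆ = P.lieMk (-P.infRho η ξ) (-P.infSigma ξ η) := fun ξ η =>
    Prod.ext (P.lieFst_lie_lieMk ξ η) (P.lieSnd_lie_lieMk ξ η)
  have hexp : ⁅P.lieMk ξ₁ η₁, P.lieMk ξ₂ η₂⁆ =
      ⁅P.lieMk ξ₁ 0, P.lieMk ξ₂ 0⁆ + ⁅P.lieMk ξ₁ 0, P.lieMk 0 η₂⁆ +
        (⁅P.lieMk 0 η₁, P.lieMk ξ₂ 0⁆ + ⁅P.lieMk 0 η₁, P.lieMk 0 η₂⁆) := by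
    rw [hsplit ξ₁ η₁, hsplit ξ₂ η₂, add_lie, lie_add, lie_add]
  have hskew : ⁅P.lieMk 0 η₁, P.lieMk ξ₂ 0⁆ = -P.lieMk (-P.infRho η₁ ξ₂) (-P.infSigma ξ₂ η₁) := by
    rw [← lie_skew, hmix]
  rw [hexp, hskew, hmix, P.lie_lieMk_left, P.lie_lieMk_right]
  have key : ∀ (a b c : E) (d e f : F), (((a, 0) + (-c, -f)) + (-(-b, -e) + (0, d)) : E × F)
      = (a + b - c, d + e - f) := by
    intro a b c d e f
    refine Prod.ext ?_ ?_
    · change a + -c + (- -b + 0) = a + b - c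
      abel
    · change 0 + -f + (- -e + d) = d + e - f
      abel
  exact key _ _ _ _ _ _

/-- The coadjoint action of `𝔤 ⋈ 𝔥` is the transpose of the bracket `lie_lieMk`. -/
theorem coad_lieMk (ξ : GroupLieAlgebra I G) (η : GroupLieAlgebra J H)
    (μ : LieDual I G) (ν : LieDual J H) :
    coad (I.prod J) (P.lieMk ξ η) (P.lieCoMk μ ν) =
      P.lieCoMk (coad I ξ μ - P.coInfRho μ η - P.aStar η ν)
        (coad J η ν + P.coInfSigma ξ ν + P.bStar ξ μ) := by
  refine ContinuousLinearMap.ext fun v => ?_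
  let ξ₂ : GroupLieAlgebra I G := P.lieFst v
  let η₂ : GroupLieAlgebra J H := P.lieSnd v
  have h1 := congrArg (fun w => -(P.lieCoMk μ ν w)) (P.lie_lieMk ξ ξ₂ η η₂)
  refine h1.trans ?_
  change -(μ (⁅ξ, ξ₂⁆ + P.infRho η ξ₂ - P.infRho η₂ ξ) +
      ν (⁅η, η₂⁆ + P.infSigma ξ₂ η - P.infSigma ξ η₂)) =
    (-μ ⁅ξ, ξ₂⁆ - μ (P.infRho η ξ₂) - ν (P.aMap η ξ₂)) +
      (-ν ⁅η, η₂⁆ + ν (P.infSigma ξ η₂) + μ (P.bMap ξ η₂))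
  rw [P.aMap_apply, P.bMap_apply, map_sub, map_sub, map_add, map_add]
  ring

/-- The variations of the components of a path and of its left-trivialized velocity. -/
theorem variations {g : ℝ → ℝ → G} {h : ℝ → ℝ → H}
    (hg : ContMDiff 𝓘(ℝ, ℝ × ℝ) I ∞ (fun p : ℝ × ℝ => g p.1 p.2))
    (hh : ContMDiff 𝓘(ℝ, ℝ × ℝ) J ∞ (fun p : ℝ × ℝ => h p.1 p.2))
    {ξ : ℝ → ℝ → GroupLieAlgebra I G} {η : ℝ → ℝ → GroupLieAlgebra J H}
    {ξ₂ : ℝ → GroupLieAlgebra I G} {η₂ : ℝ → GroupLieAlgebra J H}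
    (hX : ∀ s t, leftVelocity (I.prod J) (fun t' => P.pt (g s t') (h s t')) t
      = P.lieMk (ξ s t) (η s t))
    (hY : ∀ t, leftVelocity (I.prod J) (fun s' => P.pt (g s' t) (h s' t)) 0
      = P.lieMk (ξ₂ t) (η₂ t)) (t : ℝ) :
    velocity I (fun s' => g s' t) 0 = P.leftRhoLift (g 0 t) (h 0 t) (ξ₂ t) ∧
    velocity J (fun s' => h s' t) 0 =
      P.sigmaLift (h 0 t) (ξ₂ t) + leftLift J (h 0 t) (η₂ t) ∧
    ∃ (dξ₂ : GroupLieAlgebra I G) (dη₂ : GroupLieAlgebra J H),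
      HasDerivAt ξ₂ dξ₂ t ∧ HasDerivAt η₂ dη₂ t ∧
      HasDerivAt (fun s' => ξ s' t)
        (dξ₂ + ⁅ξ 0 t, ξ₂ t⁆ + P.infRho (η 0 t) (ξ₂ t) - P.infRho (η₂ t) (ξ 0 t)) 0 ∧
      HasDerivAt (fun s' => η s' t)
        (dη₂ + ⁅η 0 t, η₂ t⁆ + P.infSigma (ξ₂ t) (η 0 t) - P.infSigma (ξ 0 t) (η₂ t)) 0 := by
  have hΓ : ContMDiff 𝓘(ℝ, ℝ × ℝ) (I.prod J) ∞ (fun p : ℝ × ℝ => P.pt (g p.1 p.2) (h p.1 p.2)) :=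
    P.contMDiff_pt hg hh
  have hgd : MDifferentiableAt 𝓘(ℝ, ℝ) I (fun s' => g s' t) 0 :=
    (contMDiff_right_of_family (Γ := fun t s => g s t)
      (contMDiff_swap_of_family hg) t).mdifferentiableAt (by simp)
  have hhd : MDifferentiableAt 𝓘(ℝ, ℝ) J (fun s' => h s' t) 0 :=
    (contMDiff_right_of_family (Γ := fun t s => h s t)
      (contMDiff_swap_of_family hh) t).mdifferentiableAt (by simp)
  obtain ⟨h1, h2⟩ := (P.leftVelocity_pt_eq_iff hgd hhd (ξ₂ t) (η₂ t)).1 (hY t)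
  refine ⟨h1, h2, ?_⟩
  let Y : ℝ → E × F := fun t => (ξ₂ t, η₂ t)
  have hYeq : Y = fun t => leftVelocity (I.prod J) (fun s' => P.pt (g s' t) (h s' t)) 0 :=
    funext fun t => (hY t).symm
  have hYd : HasDerivAt Y (deriv Y t) t := by
    have h3 : ContDiff ℝ ∞ Y := by
      rw [hYeq]
      exact contDiff_leftVelocity_left (Γ := fun s t => P.pt (g s t) (h s t)) hΓ 0
    exact (h3.differentiable (by simp) t).hasDerivAt
  have hMC := hasDerivAt_leftVelocity_family (Γ := fun s t => P.pt (g s t) (h s t)) hΓ 0 t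
  have e1 : ⁅leftVelocity (I.prod J) (fun t' => P.pt (g 0 t') (h 0 t')) t,
      leftVelocity (I.prod J) (fun s' => P.pt (g s' t) (h s' t)) 0⁆ =
      ((⁅ξ 0 t, ξ₂ t⁆ + P.infRho (η 0 t) (ξ₂ t) - P.infRho (η₂ t) (ξ 0 t),
        ⁅η 0 t, η₂ t⁆ + P.infSigma (ξ₂ t) (η 0 t) - P.infSigma (ξ 0 t) (η₂ t)) : E × F) := by
    rw [hX, hY]
    exact P.lie_lieMk _ _ _ _
  have e2 : (fun s' => leftVelocity (I.prod J) (fun t' => P.pt (g s' t') (h s' t')) t) =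
      fun s' => P.lieMk (ξ s' t) (η s' t) := funext fun s' => hX s' t
  have hX2 : HasDerivAt (fun s' => ((ξ s' t, η s' t) : E × F)) (deriv Y t +
      ((⁅ξ 0 t, ξ₂ t⁆ + P.infRho (η 0 t) (ξ₂ t) - P.infRho (η₂ t) (ξ 0 t),
        ⁅η 0 t, η₂ t⁆ + P.infSigma (ξ₂ t) (η 0 t) - P.infSigma (ξ 0 t) (η₂ t)) : E × F)) 0 := by
    rw [e1, e2] at hMC
    rw [hYeq]
    exact hMC
  have key1 : ∀ d a b c : E, d + (a + b - c) = d + a + b - c := by intros; abel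
  have key2 : ∀ d a b c : F, d + (a + b - c) = d + a + b - c := by intros; abel
  refine ⟨(deriv Y t).1, (deriv Y t).2, hYd.fst, hYd.snd, ?_, ?_⟩
  · have := hX2.fst
    exact (congrArg (fun v : E => HasDerivAt (F := E) (fun s' => ξ s' t) v 0)
      (key1 _ _ _ _)).mp this
  · have := hX2.snd
    exact (congrArg (fun v : F => HasDerivAt (F := F) (fun s' => η s' t) v 0)
      (key2 _ _ _ _)).mp this

end Variations

end LieMatchedPair

/-! ### The first variation of the action -/

section Action

theorem hasDerivAt_intervalIntegral_of_contDiff {f : ℝ × ℝ → ℝ} (hf : ContDiff ℝ 1 f) (a b s : ℝ) :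
    HasDerivAt (fun s' => ∫ t in a..b, f (s', t)) (∫ t in a..b, fderiv ℝ f (s, t) (1, 0)) s := by
  have hd : ∀ s' t, HasDerivAt (fun s' => f (s', t)) (fderiv ℝ f (s', t) (1, 0)) s' := fun s' t =>
    HasFDerivAt.comp_hasDerivAt (x := s') (f := fun s' : ℝ => (s', t)) (l := f)
      (hf.differentiable (by simp) (s', t)).hasFDerivAt
      ((hasDerivAt_id s').prodMk (hasDerivAt_const s' t))
  have hc : Continuous (fun p : ℝ × ℝ => fderiv ℝ f p (1, 0)) :=
    (hf.continuous_fderiv (by simp)).clm_apply continuous_const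
  obtain ⟨C, hC⟩ := ((isCompact_closedBall s 1).prod
    (isCompact_uIcc (a := a) (b := b))).exists_bound_of_continuousOn hc.continuousOn
  have hslice : ∀ s', Continuous (fun t : ℝ => ((s', t) : ℝ × ℝ)) := fun s' => by fun_prop
  refine (intervalIntegral.hasDerivAt_integral_of_dominated_loc_of_deriv_le
    (F := fun s' t => f (s', t)) (F' := fun s' t => fderiv ℝ f (s', t) (1, 0))
    (bound := fun _ => C) (Metric.closedBall_mem_nhds s one_pos) ?_ ?_ ?_ ?_ ?_ ?_).2
  · exact .of_forall fun s' => (hf.continuous.comp (hslice s')).aestronglyMeasurable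
  · exact (hf.continuous.comp (hslice s)).intervalIntegrable _ _
  · exact (hc.comp (hslice s)).aestronglyMeasurable
  · exact .of_forall fun t ht s' hs' => hC (s', t) ⟨hs', Set.uIoc_subset_uIcc ht⟩
  · exact intervalIntegrable_const
  · exact .of_forall fun t _ s' _ => hd s' t

variable {E : Type*} [NormedAddCommGroup E] [NormedSpace ℝ E]
  {HE : Type*} [TopologicalSpace HE] {I : ModelWithCorners ℝ E HE}
  {K : Type*} [TopologicalSpace K] [ChartedSpace HE K] [Group K]

variable (I) in
/-- The momentum `δ𝔏/δζ` along the path `γ` with left-trivialized velocity `ζ`. -/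
noncomputable def momentum (𝔏 : K → GroupLieAlgebra I K → ℝ) (γ : ℝ → K) (t : ℝ) : LieDual I K :=
  fderiv ℝ (fun w : E => 𝔏 (γ t) w) (leftVelocity I γ t : E)

variable (I) in
/-- The force `T*_e L_γ (δ𝔏/δm)` along the path `γ`, the left-trivialized derivative of the
Lagrangian in the group variable. -/
noncomputable def force (𝔏 : K → GroupLieAlgebra I K → ℝ) (γ : ℝ → K) (t : ℝ) : LieDual I K :=
  coLeftLift I (γ t) (mfderiv I 𝓘(ℝ, ℝ) (fun x : K => 𝔏 x (leftVelocity I γ t)) (γ t))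

variable {𝔏 : K → GroupLieAlgebra I K → ℝ}

theorem leftVelocity_congr {γ γ' : ℝ → K} {t : ℝ} (h : γ =ᶠ[nhds t] γ') :
    leftVelocity I γ t = leftVelocity I γ' t := by
  have h1 : (velocity I γ t : E) = velocity I γ' t :=
    congrArg (fun A : ℝ →L[ℝ] E => A 1) h.mfderiv_eq
  exact congrArg₂ (fun (k : K) (v : E) => (mfderiv I I (fun x : K => k⁻¹ * x) k v : E))
    h.self_of_nhds h1

theorem momentum_congr {γ γ' : ℝ → K} {t : ℝ} (h : γ =ᶠ[nhds t] γ') :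
    momentum I 𝔏 γ t = momentum I 𝔏 γ' t := by
  unfold momentum
  rw [leftVelocity_congr h, h.self_of_nhds]

variable [LieGroup I ∞ K]

theorem contDiff_momentum
    (h𝔏 : ContMDiff (I.prod 𝓘(ℝ, E)) 𝓘(ℝ, ℝ) ∞ (fun p : K × E => 𝔏 p.1 p.2))
    {γ : ℝ → K} (hγ : ContMDiff 𝓘(ℝ, ℝ) I ∞ γ) :
    ContDiff (F := E →L[ℝ] ℝ) ℝ ∞ (momentum I 𝔏 γ) := by
  have h1 : ContMDiff 𝓘(ℝ, ℝ × E) 𝓘(ℝ, ℝ) ∞ (fun p : ℝ × E => 𝔏 (γ p.1) p.2) :=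
    h𝔏.comp ((hγ.comp (contDiff_fst (𝕜 := ℝ) (E := ℝ) (F := E)).contMDiff).prodMk
      (contDiff_snd (𝕜 := ℝ) (E := ℝ) (F := E)).contMDiff)
  exact ContDiff.fderiv (f := fun (t : ℝ) (w : E) => 𝔏 (γ t) w) (m := ∞) (n := ∞)
    h1.contDiff (contDiff_leftVelocity_curve hγ) le_rfl

/-- The force is a derivative at the fixed point `1`, hence depends smoothly on time. -/
theorem force_eq_mfderiv
    (h𝔏 : ContMDiff (I.prod 𝓘(ℝ, E)) 𝓘(ℝ, ℝ) ∞ (fun p : K × E => 𝔏 p.1 p.2)) (γ : ℝ → K) (t : ℝ) :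
    (force I 𝔏 γ t : E →L[ℝ] ℝ) =
      mfderiv I 𝓘(ℝ, ℝ) (fun x : K => 𝔏 (γ t * x) (leftVelocity I γ t)) 1 := by
  let ζ : E := leftVelocity I γ t
  have h1 : ContMDiff I 𝓘(ℝ, ℝ) ∞ (fun x : K => 𝔏 x ζ) :=
    h𝔏.comp (contMDiff_id.prodMk contMDiff_const)
  ext v
  exact (mfderiv_comp_apply_of_eq (I' := I) (x := (1 : K)) (y := γ t)
    (g := fun x : K => 𝔏 x ζ) (f := fun x : K => γ t * x)
    (h1.mdifferentiableAt (by simp)) (mdifferentiableAt_mul_left_of_lieGroup _ _)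
    (mul_one _) v).symm

theorem contDiff_force
    (h𝔏 : ContMDiff (I.prod 𝓘(ℝ, E)) 𝓘(ℝ, ℝ) ∞ (fun p : K × E => 𝔏 p.1 p.2))
    {γ : ℝ → K} (hγ : ContMDiff 𝓘(ℝ, ℝ) I ∞ γ) :
    ContDiff (F := E →L[ℝ] ℝ) ℝ ∞ (force I 𝔏 γ) := by
  have hζ := contDiff_leftVelocity_curve hγ
  have h1 : ContMDiff (𝓘(ℝ, ℝ).prod I) 𝓘(ℝ, ℝ) ∞
      (fun z : ℝ × K => 𝔏 (γ z.1 * z.2) (leftVelocity I γ z.1)) :=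
    h𝔏.comp (((hγ.comp contMDiff_fst).mul contMDiff_snd).prodMk
      (hζ.contMDiff.comp contMDiff_fst))
  refine contDiff_iff_contDiffAt.2 fun t => ?_
  have h2 := contMDiffAt_mfderiv_vectorSpace (I := I) (J := 𝓘(ℝ, ℝ)) (p := (1 : K)) (x₀ := t)
    (f := fun (t : ℝ) (x : K) => 𝔏 (γ t * x) (leftVelocity I γ t)) h1.contMDiffAt
  exact (contMDiffAt_iff_contDiffAt.1 h2).congr_of_eventuallyEq
    (.of_forall fun t => force_eq_mfderiv h𝔏 γ t)

theorem contDiff_lagrangian_family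
    (h𝔏 : ContMDiff (I.prod 𝓘(ℝ, E)) 𝓘(ℝ, ℝ) ∞ (fun p : K × E => 𝔏 p.1 p.2))
    {Γ : ℝ → ℝ → K} (hΓ : ContMDiff 𝓘(ℝ, ℝ × ℝ) I ∞ (fun p : ℝ × ℝ => Γ p.1 p.2)) :
    ContDiff ℝ ∞ (fun p : ℝ × ℝ => 𝔏 (Γ p.1 p.2) (leftVelocity I (Γ p.1) p.2)) := by
  have h : ContMDiff 𝓘(ℝ, ℝ × ℝ) 𝓘(ℝ, ℝ) ∞
      (fun p : ℝ × ℝ => 𝔏 (Γ p.1 p.2) (leftVelocity I (Γ p.1) p.2)) :=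
    h𝔏.comp (hΓ.prodMk (contDiff_leftVelocity hΓ).contMDiff)
  exact h.contDiff

variable [FiniteDimensional ℝ E]

variable (I) in
/-- The Euler-Lagrange covector of the path `γ`: the difference of the two sides of the
Euler-Lagrange equation. -/
noncomputable def eulerLagrange (𝔏 : K → GroupLieAlgebra I K → ℝ) (γ : ℝ → K) (t : ℝ) :
    LieDual I K :=
  force I 𝔏 γ t - coad I (leftVelocity I γ t) (momentum I 𝔏 γ t) -
    deriv (momentum I 𝔏 γ) t

theorem eulerLagrange_congr {γ γ' : ℝ → K} {t : ℝ} (h : γ =ᶠ[nhds t] γ') :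
    eulerLagrange I 𝔏 γ t = eulerLagrange I 𝔏 γ' t := by
  have h1 : momentum I 𝔏 γ =ᶠ[nhds t] momentum I 𝔏 γ' :=
    h.eventually_nhds.mono fun u hu => momentum_congr hu
  have h2 : force I 𝔏 γ t = force I 𝔏 γ' t := by
    unfold force
    rw [leftVelocity_congr h, h.self_of_nhds]
  have h3 : deriv (momentum I 𝔏 γ) t = deriv (momentum I 𝔏 γ') t :=
    Filter.EventuallyEq.deriv_eq (F := E →L[ℝ] ℝ) h1
  unfold eulerLagrange
  rw [h3, h1.self_of_nhds, h2, leftVelocity_congr h]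

/-- The bracket with a fixed vector, as a continuous linear map. -/
theorem exists_clm_lie (v : GroupLieAlgebra I K) :
    ∃ A : E →L[ℝ] E, ∀ ζ : GroupLieAlgebra I K, (⁅ζ, v⁆ : GroupLieAlgebra I K) = A ζ := by
  have : CompleteSpace E := FiniteDimensional.complete ℝ E
  have : LieGroup I (minSmoothness ℝ 3) K :=
    LieGroup.of_le (n := ∞) (by
      rw [minSmoothness_of_isRCLikeNormedField]
      exact ENat.LEInfty.out)
  let B : E →ₗ[ℝ] E := lieAd I v
  refine ⟨-LinearMap.toContinuousLinearMap B, fun ζ => ?_⟩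
  rw [← lie_skew]
  rfl

theorem contDiff_eulerLagrange_apply
    (h𝔏 : ContMDiff (I.prod 𝓘(ℝ, E)) 𝓘(ℝ, ℝ) ∞ (fun p : K × E => 𝔏 p.1 p.2))
    {γ : ℝ → K} (hγ : ContMDiff 𝓘(ℝ, ℝ) I ∞ γ) (v : GroupLieAlgebra I K) :
    ContDiff ℝ ∞ (fun t => eulerLagrange I 𝔏 γ t v) := by
  obtain ⟨A, hA⟩ := exists_clm_lie v
  have hQ := contDiff_momentum h𝔏 hγ
  have hQ' := (contDiff_infty_iff_deriv.1 hQ).2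
  let v' : E := v
  let ζ : ℝ → E := leftVelocity I γ
  let p : ℝ → E →L[ℝ] ℝ := force I 𝔏 γ
  let q : ℝ → E →L[ℝ] ℝ := momentum I 𝔏 γ
  have hp : ContDiff ℝ ∞ p := contDiff_force h𝔏 hγ
  have hq : ContDiff ℝ ∞ q := hQ
  have hq' : ContDiff ℝ ∞ (deriv q) := hQ'
  have hζ : ContDiff ℝ ∞ ζ := contDiff_leftVelocity_curve hγ
  have h4 : (fun t => eulerLagrange I 𝔏 γ t v) = fun t =>
      p t v' + q t (A (ζ t)) - deriv q t v' := by
    funext t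
    let w : E := (⁅leftVelocity I γ t, v⁆ : GroupLieAlgebra I K)
    have h5 : q t w = q t (A (ζ t)) := congrArg (q t) (hA _)
    rw [← h5, ← sub_neg_eq_add]
    rfl
  rw [h4]
  exact ((hp.clm_apply contDiff_const).add (hq.clm_apply (A.contDiff.comp hζ))).sub
    (hq'.clm_apply contDiff_const)

end Action

section FirstVariation

variable {E : Type*} [NormedAddCommGroup E] [NormedSpace ℝ E] [FiniteDimensional ℝ E]
  {HE : Type*} [TopologicalSpace HE] {I : ModelWithCorners ℝ E HE} [I.Boundaryless]
  {K : Type*} [TopologicalSpace K] [ChartedSpace HE K] [Group K] [LieGroup I ∞ K]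
  {𝔏 : K → GroupLieAlgebra I K → ℝ}

/-- The derivative of the Lagrangian along a variation, up to a total time derivative. -/
theorem fderiv_lagrangian_family
    (h𝔏 : ContMDiff (I.prod 𝓘(ℝ, E)) 𝓘(ℝ, ℝ) ∞ (fun p : K × E => 𝔏 p.1 p.2))
    {Γ : ℝ → ℝ → K} (hΓ : ContMDiff 𝓘(ℝ, ℝ × ℝ) I ∞ (fun p : ℝ × ℝ => Γ p.1 p.2)) (t : ℝ) :
    HasDerivAt
      (fun t => momentum I 𝔏 (Γ 0) t (leftVelocity I (fun s => Γ s t) 0))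
      (fderiv ℝ (fun p : ℝ × ℝ => 𝔏 (Γ p.1 p.2) (leftVelocity I (Γ p.1) p.2)) (0, t) (1, 0) -
        eulerLagrange I 𝔏 (Γ 0) t (leftVelocity I (fun s => Γ s t) 0)) t := by
  have hΓ0 := contMDiff_right_of_family hΓ 0
  let X : ℝ → E := fun s => leftVelocity I (Γ s) t
  let Y : ℝ → E := fun t => leftVelocity I (fun s => Γ s t) 0
  let q : ℝ → E →L[ℝ] ℝ := momentum I 𝔏 (Γ 0)
  let p : E →L[ℝ] ℝ := force I 𝔏 (Γ 0) t
  let br : E :=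
    (⁅leftVelocity I (Γ 0) t, leftVelocity I (fun s => Γ s t) 0⁆ : GroupLieAlgebra I K)
  have hY : HasDerivAt Y (deriv Y t) t := by
    have h : ContDiff ℝ ∞ Y := contDiff_leftVelocity_left hΓ 0
    exact (h.differentiable (by simp) t).hasDerivAt
  have hX : HasDerivAt X (deriv Y t + br) 0 := hasDerivAt_leftVelocity_family hΓ 0 t
  have hq : HasDerivAt q (deriv q t) t := by
    have h : ContDiff ℝ ∞ q := contDiff_momentum h𝔏 hΓ0
    exact (h.differentiable (by simp) t).hasDerivAt
  -- the chain rule for the Lagrangian along `s ↦ (Γ s t, X s)`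
  let f : ℝ × ℝ → ℝ := fun p => 𝔏 (Γ p.1 p.2) (leftVelocity I (Γ p.1) p.2)
  have hf : HasDerivAt (fun s => f (s, t)) (fderiv ℝ f (0, t) (1, 0)) 0 :=
    HasFDerivAt.comp_hasDerivAt (x := 0) (f := fun s : ℝ => (s, t)) (l := f)
      ((contDiff_lagrangian_family h𝔏 hΓ).differentiable (by simp) (0, t)).hasFDerivAt
      ((hasDerivAt_id 0).prodMk (hasDerivAt_const 0 t))
  have hf2 : fderiv ℝ f (0, t) (1, 0) = p (Y t) + q t (deriv Y t + br) := by
    have hΓt : MDifferentiableAt 𝓘(ℝ, ℝ) I (fun s => Γ s t) 0 :=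
      (contMDiff_right_of_family (Γ := fun t s => Γ s t)
        (contMDiff_swap_of_family hΓ) t).mdifferentiableAt (by simp)
    have hXm : HasMFDerivAt 𝓘(ℝ, ℝ) 𝓘(ℝ, E) X 0
        ((1 : ℝ →L[ℝ] ℝ).smulRight (deriv Y t + br)) := hX.hasFDerivAt.hasMFDerivAt
    have h𝔏d : MDifferentiableAt (I.prod 𝓘(ℝ, E)) 𝓘(ℝ, ℝ) (fun p : K × E => 𝔏 p.1 p.2)
        (Γ 0 t, X 0) := h𝔏.mdifferentiableAt (by simp)
    have h1 := h𝔏d.hasMFDerivAt.comp (0 : ℝ) (hΓt.hasMFDerivAt.prodMk hXm)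
    let D : E × E →L[ℝ] ℝ :=
      mfderiv (I.prod 𝓘(ℝ, E)) 𝓘(ℝ, ℝ) (fun p : K × E => 𝔏 p.1 p.2) (Γ 0 t, X 0)
    let A : ℝ →L[ℝ] E := mfderiv 𝓘(ℝ, ℝ) I (fun s => Γ s t) 0
    have h2 : HasFDerivAt (fun s => f (s, t))
        (D.comp (A.prod ((1 : ℝ →L[ℝ] ℝ).smulRight (deriv Y t + br)))) 0 :=
      hasMFDerivAt_iff_hasFDerivAt.1 h1
    have h3 := hf.unique h2.hasDerivAt
    have h4 := mfderiv_prod_eq_add_apply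
      (v := (((velocity I (fun s => Γ s t) 0 : E), deriv Y t + br) : E × E)) h𝔏d
    have h5 : ((1 : ℝ →L[ℝ] ℝ).smulRight (deriv Y t + br)) 1 = deriv Y t + br := by simp
    have h6 : fderiv ℝ f (0, t) (1, 0) =
        D ((velocity I (fun s => Γ s t) 0 : E), ((1 : ℝ →L[ℝ] ℝ).smulRight (deriv Y t + br)) 1) :=
      h3
    rw [h6, h5]
    refine h4.trans ?_
    have h7 : (velocity I (fun s => Γ s t) 0 : E) = leftLift I (Γ 0 t) (Y t) :=
      (leftLift_leftVelocity (fun s => Γ s t) 0).symm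
    have h8 : mfderiv 𝓘(ℝ, E) 𝓘(ℝ, ℝ) (fun w : E => 𝔏 (Γ 0 t) w) (X 0) = q t := mfderiv_eq_fderiv
    let B : E →L[ℝ] ℝ := mfderiv I 𝓘(ℝ, ℝ) (fun x : K => 𝔏 x (X 0)) (Γ 0 t)
    have h9 : B (velocity I (fun s => Γ s t) 0 : E) = p (Y t) := congrArg B h7
    have h10 := congrArg (fun A : E →L[ℝ] ℝ => A (deriv Y t + br)) h8
    exact congrArg₂ (fun u v : ℝ => u + v) h9 h10
  have hR : eulerLagrange I 𝔏 (Γ 0) t (Y t) = p (Y t) - -(q t br) - deriv q t (Y t) := rfl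
  have h := hq.clm_apply hY
  have he : deriv q t (Y t) + q t (deriv Y t) =
      fderiv ℝ f (0, t) (1, 0) - eulerLagrange I 𝔏 (Γ 0) t (Y t) := by
    rw [hf2, hR, map_add]
    ring
  rw [he] at h
  exact h

end FirstVariation

/-! ### Extremals with fixed endpoints -/

section Extremal

variable {E : Type*} [NormedAddCommGroup E] [NormedSpace ℝ E]
  {HE : Type*} [TopologicalSpace HE] {I : ModelWithCorners ℝ E HE}
  {K : Type*} [TopologicalSpace K] [ChartedSpace HE K] [Group K]
  [FiniteDimensional ℝ E] [I.Boundaryless] [LieGroup I ∞ K] {𝔏 : K → GroupLieAlgebra I K → ℝ}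

/-- The first variation of the action is the integral of the Euler-Lagrange covector. -/
theorem hasDerivAt_actionIntegral
    (h𝔏 : ContMDiff (I.prod 𝓘(ℝ, E)) 𝓘(ℝ, ℝ) ∞ (fun p : K × E => 𝔏 p.1 p.2))
    {a b : ℝ} (hab : a < b) {γ : ℝ → K} {Γ : ℝ → ℝ → K}
    (hΓ : IsFixedEndpointVariation I a b γ Γ) :
    HasDerivAt (fun s => actionIntegral I 𝔏 a b (Γ s))
      (∫ t in a..b, eulerLagrange I 𝔏 γ t (leftVelocity I (fun s => Γ s t) 0)) 0 := by
  let f : ℝ × ℝ → ℝ := fun p => 𝔏 (Γ p.1 p.2) (leftVelocity I (Γ p.1) p.2)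
  have hf : ContDiff ℝ ∞ f := contDiff_lagrangian_family h𝔏 hΓ.contMDiff
  have h1 := hasDerivAt_intervalIntegral_of_contDiff (hf.of_le ENat.LEInfty.out) a b 0
  let q : ℝ → E →L[ℝ] ℝ := momentum I 𝔏 (Γ 0)
  let Y : ℝ → E := fun t => leftVelocity I (fun s => Γ s t) 0
  have hq : ContDiff ℝ ∞ q := contDiff_momentum h𝔏 (contMDiff_right_of_family hΓ.contMDiff 0)
  have hY : ContDiff ℝ ∞ Y := contDiff_leftVelocity_left hΓ.contMDiff 0
  have hqY : ContDiff ℝ ∞ (fun t => q t (Y t)) := hq.clm_apply hY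
  have hc1 : Continuous (fun t => fderiv ℝ f (0, t) (1, 0)) :=
    ((hf.continuous_fderiv (by simp)).comp
      (by fun_prop : Continuous fun t : ℝ => ((0 : ℝ), t))).clm_apply continuous_const
  have hc2 : Continuous (deriv fun t => q t (Y t)) := hqY.continuous_deriv (by simp)
  have hd : ∀ t, deriv (fun t => q t (Y t)) t =
      fderiv ℝ f (0, t) (1, 0) - eulerLagrange I 𝔏 (Γ 0) t (Y t) := fun t =>
    (fderiv_lagrangian_family h𝔏 hΓ.contMDiff t).deriv
  -- the boundary terms vanish because the endpoints are fixed
  have hYa : Y a = 0 := by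
    have : (fun s => Γ s a) = fun _ => γ a := funext hΓ.left
    change leftVelocity I (fun s => Γ s a) 0 = 0
    rw [this, leftVelocity_const]
  have hYb : Y b = 0 := by
    have : (fun s => Γ s b) = fun _ => γ b := funext hΓ.right
    change leftVelocity I (fun s => Γ s b) 0 = 0
    rw [this, leftVelocity_const]
  have hbd : ∫ t in a..b, deriv (fun t => q t (Y t)) t = 0 := by
    rw [intervalIntegral.integral_deriv_eq_sub
      (fun t _ => hqY.differentiable (by simp) t) (hc2.intervalIntegrable _ _), hYa, hYb]
    simp
  have hcongr : ∫ t in a..b, eulerLagrange I 𝔏 γ t (Y t) =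
      ∫ t in a..b, (fderiv ℝ f (0, t) (1, 0) - deriv (fun t => q t (Y t)) t) := by
    -- `Γ 0` and `γ` agree only on `[a, b]`, so their derivatives are compared on the open interval
    refine intervalIntegral.integral_congr_Ioo_of_le hab.le fun t ht => ?_
    have h2 : Γ 0 =ᶠ[nhds t] γ := by
      filter_upwards [Ioo_mem_nhds ht.1 ht.2] with u hu
      exact hΓ.zero u (Set.Ioo_subset_Icc_self hu)
    change eulerLagrange I 𝔏 γ t (Y t) = _ - _
    rw [hd, ← eulerLagrange_congr h2]
    ring
  rw [intervalIntegral.integral_sub (hc1.intervalIntegrable _ _) (hc2.intervalIntegrable _ _),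
    hbd, sub_zero] at hcongr
  exact (congrArg (fun u => HasDerivAt (fun s => actionIntegral I 𝔏 a b (Γ s)) u 0)
    hcongr).mpr h1

/-- The extremals with fixed endpoints are the zeros of the Euler-Lagrange covector. -/
theorem isExtremal_iff_eulerLagrange_eq_zero
    (h𝔏 : ContMDiff (I.prod 𝓘(ℝ, E)) 𝓘(ℝ, ℝ) ∞ (fun p : K × E => 𝔏 p.1 p.2))
    {a b : ℝ} (hab : a < b) {γ : ℝ → K} (hγ : ContMDiff 𝓘(ℝ, ℝ) I ∞ γ) :
    IsExtremal I 𝔏 a b γ ↔ ∀ t ∈ Set.Icc a b, eulerLagrange I 𝔏 γ t = 0 := by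
  constructor
  · intro hext
    suffices h : ∀ v : GroupLieAlgebra I K, ∀ t ∈ Set.Icc a b, eulerLagrange I 𝔏 γ t v = 0 from
      fun t ht => ContinuousLinearMap.ext fun v => h v t ht
    intro v
    let r : ℝ → ℝ := fun t => eulerLagrange I 𝔏 γ t v
    have hr : ContDiff ℝ ∞ r := contDiff_eulerLagrange_apply h𝔏 hγ v
    -- test the first variation on the multiple of `v` that makes the integrand a square
    let φ : ℝ → ℝ := fun t => (t - a) * (b - t) * r t
    have hφ : ContDiff ℝ ∞ φ :=
      ((contDiff_id.sub contDiff_const).mul (contDiff_const.sub contDiff_id)).mul hr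
    let v' : E := v
    obtain ⟨Γ, hΓ, hΓv⟩ := exists_variation hγ (a := a) (b := b) (ζ := fun t => φ t • v')
      (hφ.smul contDiff_const) (by simp [φ]) (by simp [φ])
    have h1 := (hasDerivAt_actionIntegral h𝔏 hab hΓ).unique (hext Γ hΓ)
    have h2 : ∀ t, eulerLagrange I 𝔏 γ t (leftVelocity I (fun s => Γ s t) 0) =
        (t - a) * (b - t) * r t ^ 2 := by
      intro t
      have h3 := congrArg (eulerLagrange I 𝔏 γ t) (hΓv t)
      have h4 : eulerLagrange I 𝔏 γ t (φ t • v) = φ t * r t :=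
        (eulerLagrange I 𝔏 γ t).map_smul (φ t) v
      refine h3.trans (h4.trans ?_)
      change (t - a) * (b - t) * r t * r t = _
      ring
    simp only [h2] at h1
    have hzero : ∀ t ∈ Set.Ioo a b, r t = 0 := by
      intro t ht
      by_contra hne
      refine (intervalIntegral.integral_pos hab ?_ ?_ ⟨t, Set.Ioo_subset_Icc_self ht, ?_⟩).ne' h1
      · have := hr.continuous
        fun_prop
      · intro u hu
        have : 0 ≤ u - a := sub_nonneg.2 hu.1.le
        have : 0 ≤ b - u := sub_nonneg.2 hu.2
        positivity
      · have : 0 < t - a := sub_pos.2 ht.1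
        have : 0 < b - t := sub_pos.2 ht.2
        positivity
    -- the weight vanishes at the endpoints, which are reached by continuity
    have hcl : Set.Icc a b ⊆ {t | r t = 0} := by
      rw [← closure_Ioo hab.ne]
      exact closure_minimal hzero (isClosed_eq hr.continuous continuous_const)
    exact fun t ht => hcl ht
  · intro h Γ hΓ
    have h1 := hasDerivAt_actionIntegral h𝔏 hab hΓ
    have h2 : ∫ t in a..b, eulerLagrange I 𝔏 γ t (leftVelocity I (fun s => Γ s t) 0) = 0 := by
      rw [intervalIntegral.integral_of_le hab.le]
      refine MeasureTheory.setIntegral_eq_zero_of_forall_eq_zero fun t ht => ?_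
      rw [h t (Set.Ioc_subset_Icc_self ht)]
      rfl
    rwa [h2] at h1

/-- The extremals with fixed endpoints are the solutions of the Euler-Lagrange equation in
left-trivialized form. -/
theorem isExtremal_iff
    (h𝔏 : ContMDiff (I.prod 𝓘(ℝ, E)) 𝓘(ℝ, ℝ) ∞ (fun p : K × E => 𝔏 p.1 p.2))
    {a b : ℝ} (hab : a < b) {γ : ℝ → K} (hγ : ContMDiff 𝓘(ℝ, ℝ) I ∞ γ) :
    IsExtremal I 𝔏 a b γ ↔ ∀ t ∈ Set.Icc a b, HasDerivAt (momentum I 𝔏 γ)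
      (force I 𝔏 γ t - coad I (leftVelocity I γ t) (momentum I 𝔏 γ t)) t := by
  rw [isExtremal_iff_eulerLagrange_eq_zero h𝔏 hab hγ]
  refine forall₂_congr fun t _ => ?_
  have hq : HasDerivAt (F := E →L[ℝ] ℝ) (momentum I 𝔏 γ) (deriv (momentum I 𝔏 γ) t) t :=
    ((contDiff_momentum h𝔏 hγ).differentiable (by simp) t).hasDerivAt
  constructor
  · intro h
    rw [sub_eq_zero.1 h]
    exact hq
  · intro h
    exact sub_eq_zero.2 (HasDerivAt.unique (F := E →L[ℝ] ℝ) h hq)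

end Extremal

namespace LieMatchedPair

/-! ### The matched Euler-Lagrange equations -/

section EulerLagrange

variable {E : Type*} [NormedAddCommGroup E] [NormedSpace ℝ E]
  {HE : Type*} [TopologicalSpace HE] {I : ModelWithCorners ℝ E HE}
  {F : Type*} [NormedAddCommGroup F] [NormedSpace ℝ F]
  {HF : Type*} [TopologicalSpace HF] {J : ModelWithCorners ℝ F HF}
  {G : Type*} [TopologicalSpace G] [ChartedSpace HE G] [Group G]
  {H : Type*} [TopologicalSpace H] [ChartedSpace HF H] [Group H]
  (P : LieMatchedPair I J G H)

/-- A curve in `(𝔤 ⋈ 𝔥)*` is differentiated componentwise. -/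
theorem hasDerivAt_lieCoMk_iff {μ : ℝ → LieDual I G} {ν : ℝ → LieDual J H}
    {μ' : LieDual I G} {ν' : LieDual J H} {t : ℝ} :
    HasDerivAt (fun τ => P.lieCoMk (μ τ) (ν τ)) (P.lieCoMk μ' ν') t ↔
      HasDerivAt μ μ' t ∧ HasDerivAt ν ν' t := by
  let m : ℝ → E →L[ℝ] ℝ := μ
  let n : ℝ → F →L[ℝ] ℝ := ν
  let m' : E →L[ℝ] ℝ := μ'
  let n' : F →L[ℝ] ℝ := ν'
  change HasDerivAt (fun τ => (m τ).coprod (n τ)) (m'.coprod n') t ↔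
    HasDerivAt m m' t ∧ HasDerivAt n n' t
  constructor
  · intro h
    have h1 := h.clm_comp (hasDerivAt_const t (ContinuousLinearMap.inl ℝ E F))
    have h2 := h.clm_comp (hasDerivAt_const t (ContinuousLinearMap.inr ℝ E F))
    simp only [ContinuousLinearMap.coprod_comp_inl, ContinuousLinearMap.comp_zero,
      add_zero] at h1
    simp only [ContinuousLinearMap.coprod_comp_inr, ContinuousLinearMap.comp_zero,
      add_zero] at h2
    exact ⟨h1, h2⟩
  · rintro ⟨h1, h2⟩
    have h3 := (h1.clm_comp (hasDerivAt_const t (ContinuousLinearMap.fst ℝ E F))).add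
      (h2.clm_comp (hasDerivAt_const t (ContinuousLinearMap.snd ℝ E F)))
    simp only [ContinuousLinearMap.comp_zero, add_zero] at h3
    have e : ∀ (u : E →L[ℝ] ℝ) (w : F →L[ℝ] ℝ), u.coprod w =
        u.comp (ContinuousLinearMap.fst ℝ E F) + w.comp (ContinuousLinearMap.snd ℝ E F) :=
      fun u w => by ext <;> simp
    simp only [e]
    exact h3

variable {𝔏 : G → H → GroupLieAlgebra I G → GroupLieAlgebra J H → ℝ}

/-- A smooth function of `(g, h, ξ, η)` is smooth as a function on `(G ⋈ H) ⋉ (𝔤 ⋈ 𝔥)`: the two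
model spaces differ only in the bundling of the product. -/
theorem contMDiff_lagrangian
    (h𝔏 : ContMDiff ((I.prod J).prod (𝓘(ℝ, E).prod 𝓘(ℝ, F))) 𝓘(ℝ, ℝ) ∞
      (fun p : (G × H) × (E × F) => 𝔏 p.1.1 p.1.2 p.2.1 p.2.2)) :
    ContMDiff ((I.prod J).prod 𝓘(ℝ, E × F)) 𝓘(ℝ, ℝ) ∞
      (fun p : P.Bicrossed × (E × F) => P.lagrangian 𝔏 p.1 p.2) := by
  rw [← modelWithCornersSelf_prod, chartedSpaceSelf_prod] at h𝔏
  exact h𝔏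

theorem mfderiv_lagrangian
    (h𝔏 : ContMDiff ((I.prod J).prod (𝓘(ℝ, E).prod 𝓘(ℝ, F))) 𝓘(ℝ, ℝ) ∞
      (fun p : (G × H) × (E × F) => 𝔏 p.1.1 p.1.2 p.2.1 p.2.2))
    (g : G) (h : H) (ξ : GroupLieAlgebra I G) (η : GroupLieAlgebra J H) :
    mfderiv (I.prod J) 𝓘(ℝ, ℝ) (fun m : P.Bicrossed => P.lagrangian 𝔏 m (P.lieMk ξ η))
      (P.pt g h) = P.coMk g h (deltaG 𝔏 g h ξ η) (deltaH 𝔏 g h ξ η) := by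
  have h1 : ContMDiff (I.prod J) 𝓘(ℝ, ℝ) ∞ (fun p : G × H => 𝔏 p.1 p.2 ξ η) :=
    h𝔏.comp (contMDiff_id.prodMk (contMDiff_const (c := ((ξ, η) : E × F))))
  refine ContinuousLinearMap.ext fun v => ?_
  exact mfderiv_prod_eq_add_apply (v := v) (h1.mdifferentiableAt (x := (g, h)) (by simp))

theorem fderiv_lagrangian
    (h𝔏 : ContMDiff ((I.prod J).prod (𝓘(ℝ, E).prod 𝓘(ℝ, F))) 𝓘(ℝ, ℝ) ∞
      (fun p : (G × H) × (E × F) => 𝔏 p.1.1 p.1.2 p.2.1 p.2.2))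
    (g : G) (h : H) (ξ : GroupLieAlgebra I G) (η : GroupLieAlgebra J H) :
    (fderiv ℝ (fun w : E × F => P.lagrangian 𝔏 (P.pt g h) w) ((ξ, η) : E × F) :
      LieDual (I.prod J) P.Bicrossed) =
      P.lieCoMk (deltaXi 𝔏 g h ξ η) (deltaEta 𝔏 g h ξ η) := by
  let x : E := ξ
  let y : F := η
  let f : E × F → ℝ := fun w => P.lagrangian 𝔏 (P.pt g h) w
  have h1 : ContMDiff 𝓘(ℝ, E × F) 𝓘(ℝ, ℝ) ∞ f :=
    (P.contMDiff_lagrangian h𝔏).comp (contMDiff_const.prodMk contMDiff_id)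
  have h2 : HasFDerivAt f (fderiv ℝ f (x, y)) (x, y) :=
    (h1.contDiff.differentiable (by simp) (x, y)).hasFDerivAt
  have h3 : HasFDerivAt (fun u : E => f (u, y))
      ((fderiv ℝ f (x, y)).comp (ContinuousLinearMap.inl ℝ E F)) x :=
    HasFDerivAt.comp (g := f) (f := fun u : E => (u, y)) x h2 (hasFDerivAt_prodMk_left x y)
  have h4 : HasFDerivAt (fun u : F => f (x, u))
      ((fderiv ℝ f (x, y)).comp (ContinuousLinearMap.inr ℝ E F)) y :=
    HasFDerivAt.comp (g := f) (f := fun u : F => (x, u)) y h2 (hasFDerivAt_prodMk_right x y)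
  change fderiv ℝ f (x, y) =
    (fderiv ℝ (fun u : E => f (u, y)) x).coprod (fderiv ℝ (fun u : F => f (x, u)) y)
  rw [h3.fderiv, h4.fderiv]
  ext <;> simp

variable [FiniteDimensional ℝ E] [FiniteDimensional ℝ F] [I.Boundaryless] [J.Boundaryless]
  [LieGroup I ∞ G] [LieGroup J ∞ H]

/-- The Euler-Lagrange equation on `G ⋈ H` splits into the two matched equations. -/
theorem eulerLagrange_iff (g : ℝ → G) (h : ℝ → H)
    (ξ : ℝ → GroupLieAlgebra I G) (η : ℝ → GroupLieAlgebra J H) (t : ℝ) :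
    HasDerivAt
      (fun τ => P.lieCoMk (deltaXi 𝔏 (g τ) (h τ) (ξ τ) (η τ))
        (deltaEta 𝔏 (g τ) (h τ) (ξ τ) (η τ)))
      (coLeftLift (I.prod J) (P.pt (g t) (h t))
          (P.coMk (g t) (h t) (deltaG 𝔏 (g t) (h t) (ξ t) (η t))
            (deltaH 𝔏 (g t) (h t) (ξ t) (η t)))
        - coad (I.prod J) (P.lieMk (ξ t) (η t))
          (P.lieCoMk (deltaXi 𝔏 (g t) (h t) (ξ t) (η t))
            (deltaEta 𝔏 (g t) (h t) (ξ t) (η t)))) t ↔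
    (HasDerivAt (fun τ => deltaXi 𝔏 (g τ) (h τ) (ξ τ) (η τ))
      (P.coRho (coLeftLift I (g t) (deltaG 𝔏 (g t) (h t) (ξ t) (η t))) (h t)
        + P.coSigmaLift (h t) (deltaH 𝔏 (g t) (h t) (ξ t) (η t))
        - coad I (ξ t) (deltaXi 𝔏 (g t) (h t) (ξ t) (η t))
        + P.coInfRho (deltaXi 𝔏 (g t) (h t) (ξ t) (η t)) (η t)
        + P.aStar (η t) (deltaEta 𝔏 (g t) (h t) (ξ t) (η t))) t ∧
    HasDerivAt (fun τ => deltaEta 𝔏 (g τ) (h τ) (ξ τ) (η τ))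
      (coLeftLift J (h t) (deltaH 𝔏 (g t) (h t) (ξ t) (η t))
        - coad J (η t) (deltaEta 𝔏 (g t) (h t) (ξ t) (η t))
        - P.coInfSigma (ξ t) (deltaEta 𝔏 (g t) (h t) (ξ t) (η t))
        - P.bStar (ξ t) (deltaXi 𝔏 (g t) (h t) (ξ t) (η t))) t) := by
  rw [P.coLeftLift_pt, P.coad_lieMk, ← P.hasDerivAt_lieCoMk_iff]
  have key : ∀ (u p q r s : E →L[ℝ] ℝ) (w l m n : F →L[ℝ] ℝ),
      (u + p).coprod w - (q - r - s).coprod (l + m + n) =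
        (u + p - q + r + s).coprod (w - l - m - n) := by
    intros
    ext <;> simp <;> ring
  exact iff_of_eq (congrArg (fun u : E × F →L[ℝ] ℝ => HasDerivAt (F := E × F →L[ℝ] ℝ)
    (fun τ => P.lieCoMk (deltaXi 𝔏 (g τ) (h τ) (ξ τ) (η τ))
        (deltaEta 𝔏 (g τ) (h τ) (ξ τ) (η τ))) u t) (key _ _ _ _ _ _ _ _ _))

/-- On `G ⋈ H` the momentum and the force have the partial derivatives of `𝔏` as their components,
so that `isExtremal_iff` becomes the Euler-Lagrange equation in components. -/
theorem isExtremal_pt_iff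
    (h𝔏 : ContMDiff ((I.prod J).prod (𝓘(ℝ, E).prod 𝓘(ℝ, F))) 𝓘(ℝ, ℝ) ∞
      (fun p : (G × H) × (E × F) => 𝔏 p.1.1 p.1.2 p.2.1 p.2.2))
    {a b : ℝ} {g : ℝ → G} {h : ℝ → H} (hab : a < b)
    (hg : ContMDiff 𝓘(ℝ, ℝ) I ∞ g) (hh : ContMDiff 𝓘(ℝ, ℝ) J ∞ h)
    {ξ : ℝ → GroupLieAlgebra I G} {η : ℝ → GroupLieAlgebra J H}
    (hζ : ∀ t, leftVelocity (I.prod J) (fun t' => P.pt (g t') (h t')) t = P.lieMk (ξ t) (η t)) :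
    IsExtremal (I.prod J) (P.lagrangian 𝔏) a b (fun t => P.pt (g t) (h t)) ↔
      ∀ t ∈ Set.Icc a b, HasDerivAt
        (fun τ => P.lieCoMk (deltaXi 𝔏 (g τ) (h τ) (ξ τ) (η τ))
          (deltaEta 𝔏 (g τ) (h τ) (ξ τ) (η τ)))
        (coLeftLift (I.prod J) (P.pt (g t) (h t))
            (P.coMk (g t) (h t) (deltaG 𝔏 (g t) (h t) (ξ t) (η t))
              (deltaH 𝔏 (g t) (h t) (ξ t) (η t)))
          - coad (I.prod J) (P.lieMk (ξ t) (η t))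
            (P.lieCoMk (deltaXi 𝔏 (g t) (h t) (ξ t) (η t))
              (deltaEta 𝔏 (g t) (h t) (ξ t) (η t)))) t := by
  rw [isExtremal_iff (P.contMDiff_lagrangian h𝔏) hab (P.contMDiff_pt hg hh)]
  refine forall₂_congr fun t _ => ?_
  have hm : momentum (I.prod J) (P.lagrangian 𝔏) (fun t => P.pt (g t) (h t)) =
      fun τ => P.lieCoMk (deltaXi 𝔏 (g τ) (h τ) (ξ τ) (η τ))
        (deltaEta 𝔏 (g τ) (h τ) (ξ τ) (η τ)) := by
    funext τ
    rw [← P.fderiv_lagrangian h𝔏]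
    unfold momentum
    rw [hζ]
    rfl
  have hf : force (I.prod J) (P.lagrangian 𝔏) (fun t => P.pt (g t) (h t)) t =
      coLeftLift (I.prod J) (P.pt (g t) (h t))
        (P.coMk (g t) (h t) (deltaG 𝔏 (g t) (h t) (ξ t) (η t))
          (deltaH 𝔏 (g t) (h t) (ξ t) (η t))) := by
    unfold force
    rw [hζ, P.mfderiv_lagrangian h𝔏]
  rw [hf, hζ, hm]

end EulerLagrange

end LieMatchedPair

theorem mainTheorem2
    {E : Type*} [NormedAddCommGroup E] [NormedSpace ℝ E] [FiniteDimensional ℝ E]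
    {HE : Type*} [TopologicalSpace HE] {I : ModelWithCorners ℝ E HE} [I.Boundaryless]
    {F : Type*} [NormedAddCommGroup F] [NormedSpace ℝ F] [FiniteDimensional ℝ F]
    {HF : Type*} [TopologicalSpace HF] {J : ModelWithCorners ℝ F HF} [J.Boundaryless]
    {G : Type*} [TopologicalSpace G] [ChartedSpace HE G] [Group G] [LieGroup I ∞ G]
    {H : Type*} [TopologicalSpace H] [ChartedSpace HF H] [Group H] [LieGroup J ∞ H]
    (P : LieMatchedPair I J G H) :
    -- the bracket of `𝔤 ⋈ 𝔥`, the Lie algebra of `G ⋈ H`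
    (∀ (ξ₁ ξ₂ : GroupLieAlgebra I G) (η₁ η₂ : GroupLieAlgebra J H),
      ⁅P.lieMk ξ₁ η₁, P.lieMk ξ₂ η₂⁆ =
        P.lieMk (⁅ξ₁, ξ₂⁆ + P.infRho η₁ ξ₂ - P.infRho η₂ ξ₁)
          (⁅η₁, η₂⁆ + P.infSigma ξ₂ η₁ - P.infSigma ξ₁ η₂)) ∧
    -- the cotangent lift of left translation
    (∀ (g : G) (h : H) (α : CotangentSpace I g) (β : CotangentSpace J h),
      coLeftLift (I.prod J) (P.pt g h) (P.coMk g h α β) =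
        P.lieCoMk (P.coRho (coLeftLift I g α) h + P.coSigmaLift h β) (coLeftLift J h β)) ∧
    -- the coadjoint action
    (∀ (ξ : GroupLieAlgebra I G) (η : GroupLieAlgebra J H) (μ : LieDual I G) (ν : LieDual J H),
      coad (I.prod J) (P.lieMk ξ η) (P.lieCoMk μ ν) =
        P.lieCoMk (coad I ξ μ - P.coInfRho μ η - P.aStar η ν)
          (coad J η ν + P.coInfSigma ξ ν + P.bStar ξ μ)) ∧
    -- the variations induced by a family of paths `t ↦ (g s t, h s t)`
    (∀ (g : ℝ → ℝ → G) (h : ℝ → ℝ → H),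
      ContMDiff 𝓘(ℝ, ℝ × ℝ) I ∞ (fun p : ℝ × ℝ => g p.1 p.2) →
      ContMDiff 𝓘(ℝ, ℝ × ℝ) J ∞ (fun p : ℝ × ℝ => h p.1 p.2) →
      ∀ (ξ : ℝ → ℝ → GroupLieAlgebra I G) (η : ℝ → ℝ → GroupLieAlgebra J H)
        (ξ₂ : ℝ → GroupLieAlgebra I G) (η₂ : ℝ → GroupLieAlgebra J H),
      (∀ s t, leftVelocity (I.prod J) (fun t' => P.pt (g s t') (h s t')) t
        = P.lieMk (ξ s t) (η s t)) →
      (∀ t, leftVelocity (I.prod J) (fun s' => P.pt (g s' t) (h s' t)) 0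
        = P.lieMk (ξ₂ t) (η₂ t)) →
      ∀ t : ℝ,
        velocity I (fun s' => g s' t) 0 = P.leftRhoLift (g 0 t) (h 0 t) (ξ₂ t) ∧
        velocity J (fun s' => h s' t) 0 =
          P.sigmaLift (h 0 t) (ξ₂ t) + leftLift J (h 0 t) (η₂ t) ∧
        ∃ (dξ₂ : GroupLieAlgebra I G) (dη₂ : GroupLieAlgebra J H),
          HasDerivAt ξ₂ dξ₂ t ∧ HasDerivAt η₂ dη₂ t ∧
          HasDerivAt (fun s' => ξ s' t)
            (dξ₂ + ⁅ξ 0 t, ξ₂ t⁆ + P.infRho (η 0 t) (ξ₂ t) - P.infRho (η₂ t) (ξ 0 t)) 0 ∧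
          HasDerivAt (fun s' => η s' t)
            (dη₂ + ⁅η 0 t, η₂ t⁆ + P.infSigma (ξ₂ t) (η 0 t) - P.infSigma (ξ 0 t) (η₂ t)) 0) ∧
    -- every smooth `(ξ₂, η₂)` that vanishes at the endpoints comes from a variation
    (∀ (a b : ℝ) (g : ℝ → G) (h : ℝ → H), a < b →
      ContMDiff 𝓘(ℝ, ℝ) I ∞ g → ContMDiff 𝓘(ℝ, ℝ) J ∞ h →
      ∀ (ξ₂ : ℝ → E) (η₂ : ℝ → F), ContDiff ℝ ∞ ξ₂ → ContDiff ℝ ∞ η₂ →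
      ξ₂ a = 0 → ξ₂ b = 0 → η₂ a = 0 → η₂ b = 0 →
      ∃ Γ : ℝ → ℝ → P.Bicrossed,
        IsFixedEndpointVariation (I.prod J) a b (fun t => P.pt (g t) (h t)) Γ ∧
        ∀ t ∈ Set.Icc a b,
          leftVelocity (I.prod J) (fun s => Γ s t) 0 = P.lieMk (ξ₂ t) (η₂ t)) ∧
    -- the Euler-Lagrange equations of a Lagrangian on `(G ⋈ H) ⋉ (𝔤 ⋈ 𝔥)`
    (∀ 𝔏 : G → H → GroupLieAlgebra I G → GroupLieAlgebra J H → ℝ,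
      ContMDiff ((I.prod J).prod (𝓘(ℝ, E).prod 𝓘(ℝ, F))) 𝓘(ℝ, ℝ) ∞
        (fun p : (G × H) × (E × F) => 𝔏 p.1.1 p.1.2 p.2.1 p.2.2) →
      -- the equation on `G ⋈ H` is the coupled system, for all curves
      (∀ (g : ℝ → G) (h : ℝ → H)
        (ξ : ℝ → GroupLieAlgebra I G) (η : ℝ → GroupLieAlgebra J H) (t : ℝ),
        HasDerivAt
          (fun τ => P.lieCoMk (deltaXi 𝔏 (g τ) (h τ) (ξ τ) (η τ))
            (deltaEta 𝔏 (g τ) (h τ) (ξ τ) (η τ)))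
          (coLeftLift (I.prod J) (P.pt (g t) (h t))
              (P.coMk (g t) (h t) (deltaG 𝔏 (g t) (h t) (ξ t) (η t))
                (deltaH 𝔏 (g t) (h t) (ξ t) (η t)))
            - coad (I.prod J) (P.lieMk (ξ t) (η t))
              (P.lieCoMk (deltaXi 𝔏 (g t) (h t) (ξ t) (η t))
                (deltaEta 𝔏 (g t) (h t) (ξ t) (η t)))) t ↔
        (HasDerivAt (fun τ => deltaXi 𝔏 (g τ) (h τ) (ξ τ) (η τ))
          (P.coRho (coLeftLift I (g t) (deltaG 𝔏 (g t) (h t) (ξ t) (η t))) (h t)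
            + P.coSigmaLift (h t) (deltaH 𝔏 (g t) (h t) (ξ t) (η t))
            - coad I (ξ t) (deltaXi 𝔏 (g t) (h t) (ξ t) (η t))
            + P.coInfRho (deltaXi 𝔏 (g t) (h t) (ξ t) (η t)) (η t)
            + P.aStar (η t) (deltaEta 𝔏 (g t) (h t) (ξ t) (η t))) t ∧
        HasDerivAt (fun τ => deltaEta 𝔏 (g τ) (h τ) (ξ τ) (η τ))
          (coLeftLift J (h t) (deltaH 𝔏 (g t) (h t) (ξ t) (η t))
            - coad J (η t) (deltaEta 𝔏 (g t) (h t) (ξ t) (η t))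
            - P.coInfSigma (ξ t) (deltaEta 𝔏 (g t) (h t) (ξ t) (η t))
            - P.bStar (ξ t) (deltaXi 𝔏 (g t) (h t) (ξ t) (η t))) t)) ∧
      -- the extremals with fixed endpoints are the solutions of the coupled system
      (∀ (a b : ℝ) (g : ℝ → G) (h : ℝ → H), a < b →
        ContMDiff 𝓘(ℝ, ℝ) I ∞ g → ContMDiff 𝓘(ℝ, ℝ) J ∞ h →
        ∀ (ξ : ℝ → GroupLieAlgebra I G) (η : ℝ → GroupLieAlgebra J H),
        (∀ t, leftVelocity (I.prod J) (fun t' => P.pt (g t') (h t')) t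
          = P.lieMk (ξ t) (η t)) →
        (IsExtremal (I.prod J) (P.lagrangian 𝔏) a b (fun t => P.pt (g t) (h t)) ↔
          ∀ t ∈ Set.Icc a b,
            HasDerivAt (fun τ => deltaXi 𝔏 (g τ) (h τ) (ξ τ) (η τ))
              (P.coRho (coLeftLift I (g t) (deltaG 𝔏 (g t) (h t) (ξ t) (η t))) (h t)
                + P.coSigmaLift (h t) (deltaH 𝔏 (g t) (h t) (ξ t) (η t))
                - coad I (ξ t) (deltaXi 𝔏 (g t) (h t) (ξ t) (η t))
                + P.coInfRho (deltaXi 𝔏 (g t) (h t) (ξ t) (η t)) (η t)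
                + P.aStar (η t) (deltaEta 𝔏 (g t) (h t) (ξ t) (η t))) t ∧
            HasDerivAt (fun τ => deltaEta 𝔏 (g τ) (h τ) (ξ τ) (η τ))
              (coLeftLift J (h t) (deltaH 𝔏 (g t) (h t) (ξ t) (η t))
                - coad J (η t) (deltaEta 𝔏 (g t) (h t) (ξ t) (η t))
                - P.coInfSigma (ξ t) (deltaEta 𝔏 (g t) (h t) (ξ t) (η t))
                - P.bStar (ξ t) (deltaXi 𝔏 (g t) (h t) (ξ t) (η t))) t))) := by
  refine ⟨fun ξ₁ ξ₂ η₁ η₂ => P.lie_lieMk ξ₁ ξ₂ η₁ η₂, P.coLeftLift_pt, P.coad_lieMk,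
    fun g h hg hh ξ η ξ₂ η₂ hX hY t => P.variations hg hh hX hY t, ?_, ?_⟩
  · intro a b g h _ hg hh ξ₂ η₂ hξ hη ha hb ha' hb'
    obtain ⟨Γ, hΓ, hv⟩ := exists_variation (P.contMDiff_pt hg hh) (a := a) (b := b)
      (ζ := fun t => (ξ₂ t, η₂ t)) (hξ.prodMk hη) (Prod.ext ha ha') (Prod.ext hb hb')
    exact ⟨Γ, hΓ, fun t _ => hv t⟩
  · intro 𝔏 h𝔏
    exact ⟨fun g h ξ η t => P.eulerLagrange_iff g h ξ η t, fun a b g h hab hg hh ξ η hζ =>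
      (P.isExtremal_pt_iff h𝔏 hab hg hh hζ).trans
        (forall₂_congr fun t _ => P.eulerLagrange_iff g h ξ η t)⟩
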